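/- Let $A$ be a finite alphabet with $N\ge 2$ letters and let $F_N$ be the free group with basis $A$. Its boundary $\partial F_N$ is the set of infinite reduced words in the letters of $A\cup A^{-1}$, with the topology induced from the product of discrete spaces, and $\partial^2F_N=(\partial F_N\times\partial F_N)\setminus\Delta$, where $\Delta$ is the diagonal. An automorphism $\psi$ of $F_N$ induces homeomorphisms $\partial\psi(V)=\lim_n\psi(V_0\cdots V_{n-1})$ of $\partial F_N$ and $\partial^2\psi=\partial\psi\times\partial\psi$ of $\partial^2F_N$. The shift map is $S(X,Y)=(Y_0^{-1}X,Y_0^{-1}Y)$, where $Y_0$ is the first letter of $Y$. For $w\in F_N$, let $i_w$ be the automorphism $v\mapsto w^{-1}vw$. **Singularities.** Let $\varphi$ be a positive primitive automorphism of $F_N$ (the words $\varphi(a)$, $a\in A$, have all their letters in $A$, and for some $k\ge1$ every letter of $A$ occurs in $\varphi^k(a)$ for every $a\in A$). Choose $a\in A$ and $k\ge 1$ with $\varphi^k(a)=pas$, where $p,s$ are non-empty words in the letters of $A$, and put $X=\lim_n p^{-1}\varphi^k(p^{-1})\cdots\varphi^{nk}(p^{-1})$, $Y=\lim_n as\,\varphi^k(s)\cdots\varphi^{nk}(s)$.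 The attracting subshift $\Sigma_\varphi$ is the closure in $\partial^2F_N$ of $\{S^n(X,Y):n\in\mathbb Z\}$ (where $S^{-1}(U,V)=(U_0^{-1}U,U_0^{-1}V)$ along this orbit); it does not depend on the choices. A set $\Omega\subseteq\Sigma_\varphi$ with at least two elements is a *$\varphi$-singularity fixed by* $\psi$ if (i) $\psi=i_w\circ\varphi^k$ for some $w\in F_N$ and some integer $k\ge1$, and every point of $\Omega$ is fixed by $\partial^2\psi$; (ii) for every $h\ge1$, every point of $\Sigma_\varphi$ that is fixed by $\partial^2\psi^h$ belongs to $\Omega$; (iii) there are $(U,V),(U',V')\in\Omega$ with $V_0\ne V_0'$ or $U_0\neq U_0'$. It is a *$\varphi$-singularity* if it is a $\varphi$-singularity fixed by some such $\psi$. **Self-induced CIETs.** A completed interval exchange transformation (CIET) $\delta=(\pi,\lambda)$ is given by a pair $\pi=(\pi_0,\pi_1)$ of bijections $A\to\{0,\dots,N-1\}$ and a vector $\lambda=(\lambda_a)_{a\in A}$ of positive reals. It is the system of translations $\delta_a:[\Lambda_0(a),\Lambda_0(a)+\lambda_a]\to[\Lambda_1(a),\Lambda_1(a)+\lambda_a]$,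 $a\in A$, where $\Lambda_\varepsilon(a)=\sum_{\pi_\varepsilon(b)<\pi_\varepsilon(a)}\lambda_b$. Put $\alpha_0=\pi_0^{-1}(N-1)$ and $\alpha_1=\pi_1^{-1}(N-1)$. If $\lambda_{\alpha_0}\ne\lambda_{\alpha_1}$, the Rauzy induction $R(\delta)=(\pi',\lambda')$ and its Dehn twist $\sigma$ are defined as follows. * If $\lambda_{\alpha_0}>\lambda_{\alpha_1}$: $\pi_0'=\pi_0$; $\pi_1'(a)=\pi_1(a)$ if $\pi_1(a)\le\pi_1(\alpha_0)$, $\pi_1'(\alpha_1)=\pi_1(\alpha_0)+1$, and $\pi_1'(a)=\pi_1(a)+1$ if $\pi_1(\alpha_0)<\pi_1(a)<\pi_1(\alpha_1)$; $\lambda'_{\alpha_0}=\lambda_{\alpha_0}-\lambda_{\alpha_1}$ and $\lambda'_a=\lambda_a$ for $a\ne\alpha_0$; $\sigma$ maps $\alpha_1$ to $\alpha_1\alpha_0$ and fixes the other letters. * If $\lambda_{\alpha_0}<\lambda_{\alpha_1}$: $\pi_1'=\pi_1$; $\pi_0'(a)=\pi_0(a)$ if $\pi_0(a)\le\pi_0(\alpha_1)$,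 $\pi_0'(\alpha_0)=\pi_0(\alpha_1)+1$, and $\pi_0'(a)=\pi_0(a)+1$ if $\pi_0(\alpha_1)<\pi_0(a)<\pi_0(\alpha_0)$; $\lambda'_{\alpha_1}=\lambda_{\alpha_1}-\lambda_{\alpha_0}$ and $\lambda'_a=\lambda_a$ for $a\ne\alpha_1$; $\sigma$ maps $\alpha_0$ to $\alpha_1\alpha_0$ and fixes the other letters. The CIET $\delta$ is *self-induced* if for some $n\ge1$ the CIET $R^n(\delta)$ is defined and equal to $(\pi,\eta\lambda)$ for some real $\eta>0$. Its *$\delta$-automorphism* is $\varphi=\sigma_0\circ\sigma_1\circ\dots\circ\sigma_{n-1}$, where $n$ is the least such integer and $\sigma_i$ is the Dehn twist of the induction from $R^i(\delta)$ to $R^{i+1}(\delta)$; it is a positive primitive automorphism of $F_N$. **Proposition.** Let $\delta$ be a self-induced CIET and let $\varphi$ be its $\delta$-automorphism. For every $\varphi$-singularity $\Omega$ there is $w\in F_N$ such that $\Omega$ is a $\varphi$-singularity fixed by $i_w\circ\varphi$. -/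

import Mathlib

/-! ### The boundary and the double boundary of a free group

A letter is a pair `(a, b) : A × Bool`, as in Mathlib's `FreeGroup`: `(a, true)` is the generator
`a`, and `(a, false)` is its inverse. -/

/-- The inverse of a letter. -/
def letterInv {A : Type*} (l : A × Bool) : A × Bool := (l.1, !l.2)

theorem letterInv_letterInv {A : Type*} (l : A × Bool) : letterInv (letterInv l) = l := by
  simp [letterInv]

theorem letterInv_ne {A : Type*} (l : A × Bool) : letterInv l ≠ l := by
  rcases l with ⟨a, b⟩
  simp [letterInv]

/-- The Gromov boundary of the free group on `A`: infinite reduced words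
`V₀ V₁ V₂ …` in the letters of `A` and their inverses. -/
@[ext]
structure FreeBoundary (A : Type*) where
  /-- The `i`-th letter of the word. -/
  letter : ℕ → A × Bool
  reduced : ∀ i, letter (i + 1) ≠ letterInv (letter i)

namespace FreeBoundary

/-- The topology of the boundary: that of a subspace of a product of discrete spaces. -/
instance instTopologicalSpace {A : Type*} : TopologicalSpace (FreeBoundary A) :=
  TopologicalSpace.induced letter (@Pi.topologicalSpace ℕ (fun _ => A × Bool) (fun _ => ⊥))

/-- The element `V₀ V₁ ⋯ Vₙ₋₁` of the free group. -/
def initial {A : Type*} (V : FreeBoundary A) (n : ℕ) : FreeGroup A :=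
  FreeGroup.mk ((List.range n).map V.letter)

/-- The product `l V` of a letter and an infinite reduced word, in reduced form. -/
def letterMul {A : Type*} [DecidableEq A] (l : A × Bool) (V : FreeBoundary A) : FreeBoundary A :=
  if h : V.letter 0 = letterInv l then
    ⟨fun i => V.letter (i + 1), fun i => V.reduced (i + 1)⟩
  else
    ⟨fun i => Nat.casesOn i l V.letter, fun i => by
      cases i with
      | zero => exact h
      | succ i => exact V.reduced i⟩

theorem letterMul_letterInv {A : Type*} [DecidableEq A] (l : A × Bool) (V : FreeBoundary A) :
    letterMul (letterInv l) (letterMul l V) = V := by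
  by_cases h : V.letter 0 = letterInv l
  · have h1 : V.letter 1 ≠ l := by
      have := V.reduced 0
      rwa [h, letterInv_letterInv] at this
    ext1
    funext i
    cases i with
    | zero => simp [letterMul, h, letterInv_letterInv, h1]
    | succ i => simp [letterMul, h, letterInv_letterInv, h1]
  · simp [letterMul, h, letterInv_letterInv]

/-- The elements `g n` of the free group converge to the boundary point `V`: for every `i`, the
`i`-th letter of the reduced word of `g n` is eventually the `i`-th letter of `V`. -/
def IsLimit {A : Type*} [DecidableEq A] (g : ℕ → FreeGroup A) (V : FreeBoundary A) : Prop :=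
  ∀ i : ℕ, ∀ᶠ n in Filter.atTop, (g n).toWord[i]? = some (V.letter i)

/-- `W = ∂φ (V)`, where `∂φ` is the map that the automorphism `φ` induces on the boundary:
`W` is the limit of `φ (V₀ V₁ ⋯ Vₙ₋₁)`. -/
def MapsTo {A : Type*} [DecidableEq A] (φ : MulAut (FreeGroup A)) (V W : FreeBoundary A) : Prop :=
  IsLimit (fun n => φ (V.initial n)) W

end FreeBoundary

/-- The double boundary: pairs `(U, V)` of distinct points of the boundary. -/
@[ext]
structure DoubleBoundary (A : Type*) where
  fst : FreeBoundary A
  snd : FreeBoundary A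
  fst_ne_snd : fst ≠ snd

namespace DoubleBoundary

/-- The topology of the double boundary: that of a subspace of the product. -/
instance instTopologicalSpace {A : Type*} : TopologicalSpace (DoubleBoundary A) :=
  TopologicalSpace.induced (fun Z => (Z.fst, Z.snd)) inferInstance

/-- The point `(l U, l V)`, for a letter `l`. -/
def letterMul {A : Type*} [DecidableEq A] (l : A × Bool) (Z : DoubleBoundary A) :
    DoubleBoundary A where
  fst := Z.fst.letterMul l
  snd := Z.snd.letterMul l
  fst_ne_snd := fun h => Z.fst_ne_snd <| by
    have := congrArg (FreeBoundary.letterMul (letterInv l)) h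
    simpa only [FreeBoundary.letterMul_letterInv] using this

theorem letterMul_letterInv {A : Type*} [DecidableEq A] (l : A × Bool) (Z : DoubleBoundary A) :
    letterMul (letterInv l) (letterMul l Z) = Z := by
  ext1
  · exact FreeBoundary.letterMul_letterInv l Z.fst
  · exact FreeBoundary.letterMul_letterInv l Z.snd

/-- The shift map `S (U, V) = (V₀⁻¹ U, V₀⁻¹ V)`. -/
def shift {A : Type*} [DecidableEq A] (Z : DoubleBoundary A) : DoubleBoundary A :=
  letterMul (letterInv (Z.snd.letter 0)) Z

/-- The map `(U, V) ↦ (U₀⁻¹ U, U₀⁻¹ V)`. It is inverse to the shift map on the set of points with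
`U₀ ≠ V₀`, which contains all the points of attracting subshifts (see `shift_shiftInv`,
`shiftInv_shift`). -/
def shiftInv {A : Type*} [DecidableEq A] (Z : DoubleBoundary A) : DoubleBoundary A :=
  letterMul (letterInv (Z.fst.letter 0)) Z

theorem shift_shiftInv {A : Type*} [DecidableEq A] (Z : DoubleBoundary A)
    (h : Z.fst.letter 0 ≠ Z.snd.letter 0) : shift (shiftInv Z) = Z := by
  have h0 : (shiftInv Z).snd.letter 0 = letterInv (Z.fst.letter 0) := by
    simp [shiftInv, letterMul, FreeBoundary.letterMul, letterInv_letterInv, h.symm]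
  unfold shift
  rw [h0]
  exact letterMul_letterInv _ _

theorem shiftInv_shift {A : Type*} [DecidableEq A] (Z : DoubleBoundary A)
    (h : Z.fst.letter 0 ≠ Z.snd.letter 0) : shiftInv (shift Z) = Z := by
  have h0 : (shift Z).fst.letter 0 = letterInv (Z.snd.letter 0) := by
    simp [shift, letterMul, FreeBoundary.letterMul, letterInv_letterInv, h]
  unfold shiftInv
  rw [h0]
  exact letterMul_letterInv _ _

/-- The power `Sⁿ`, `n ∈ ℤ`, of the shift map. -/
def shiftPow {A : Type*} [DecidableEq A] : ℤ → DoubleBoundary A → DoubleBoundary A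
  | Int.ofNat n, Z => shift^[n] Z
  | Int.negSucc n, Z => shiftInv^[n + 1] Z

/-- `Z` is a fixed point of the map `∂²φ` that `φ` induces on the double boundary. -/
def IsFixed {A : Type*} [DecidableEq A] (φ : MulAut (FreeGroup A)) (Z : DoubleBoundary A) : Prop :=
  FreeBoundary.MapsTo φ Z.fst Z.fst ∧ FreeBoundary.MapsTo φ Z.snd Z.snd

end DoubleBoundary

/-! ### The attracting subshift and the singularities of an automorphism -/

/-- All the letters of the reduced word `g` are generators (not inverses of generators). -/
def IsPositiveWord {A : Type*} [DecidableEq A] (g : FreeGroup A) : Prop :=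
  ∀ l ∈ g.toWord, l.2 = true

/-- `Z = (X, Y)` is a point from which the attracting subshift of `φ` is generated: there are
`a ∈ A` and `k ≥ 1` with `φᵏ(a) = p a s`, where `p`, `s` are nonempty positive words,
`X = lim p⁻¹ φᵏ(p⁻¹) ⋯ φⁿᵏ(p⁻¹)` and `Y = lim a s φᵏ(s) ⋯ φⁿᵏ(s)`. -/
def IsAttractingPoint {A : Type*} [DecidableEq A] (φ : MulAut (FreeGroup A))
    (Z : DoubleBoundary A) : Prop :=
  ∃ (a : A) (k : ℕ) (p s : FreeGroup A), 1 ≤ k ∧ p ≠ 1 ∧ s ≠ 1 ∧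
    IsPositiveWord p ∧ IsPositiveWord s ∧
    (φ ^ k) (FreeGroup.of a) = p * FreeGroup.of a * s ∧
    FreeBoundary.IsLimit
      (fun n => ((List.range (n + 1)).map fun i => (φ ^ (i * k)) p⁻¹).prod) Z.fst ∧
    FreeBoundary.IsLimit
      (fun n => FreeGroup.of a * ((List.range (n + 1)).map fun i => (φ ^ (i * k)) s).prod) Z.snd

/-- The attracting subshift of `φ`: the closure of the shift orbit of a generating point. (For a
positive primitive automorphism this closure does not depend on the point, so that the
union over all generating points is the closure of the orbit of any one of them.) -/
def attractingSubshift {A : Type*} [DecidableEq A] (φ : MulAut (FreeGroup A)) :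
    Set (DoubleBoundary A) :=
  {W | ∃ Z, IsAttractingPoint φ Z ∧ W ∈ closure (Set.range fun n : ℤ => Z.shiftPow n)}

/-- The conjugacy `i_w : v ↦ w⁻¹ v w`. -/
def conjugacy {A : Type*} (w : FreeGroup A) : MulAut (FreeGroup A) := MulAut.conj w⁻¹

/-- `Ω` is a `φ`-singularity, and the automorphism `ψ` fixes the singularity `Ω`. -/
structure FixesSingularity {A : Type*} [DecidableEq A] (φ ψ : MulAut (FreeGroup A))
    (Ω : Set (DoubleBoundary A)) : Prop where
  subset : Ω ⊆ attractingSubshift φ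
  /-- `Ω` has at least two elements. -/
  nontrivial : Ω.Nontrivial
  /-- `ψ = i_w ∘ φᵏ` for some `w` and some `k ≥ 1`. -/
  eq_conjugacy_mul : ∃ (w : FreeGroup A) (k : ℕ), 1 ≤ k ∧ ψ = conjugacy w * φ ^ k
  isFixed : ∀ Z ∈ Ω, Z.IsFixed ψ
  mem_of_isFixed : ∀ h : ℕ, 1 ≤ h → ∀ Z ∈ attractingSubshift φ, Z.IsFixed (ψ ^ h) → Z ∈ Ω
  exists_ne : ∃ Z ∈ Ω, ∃ Z' ∈ Ω,
    Z.snd.letter 0 ≠ Z'.snd.letter 0 ∨ Z.fst.letter 0 ≠ Z'.fst.letter 0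

/-- `Ω` is a `φ`-singularity. -/
def IsSingularity {A : Type*} [DecidableEq A] (φ : MulAut (FreeGroup A))
    (Ω : Set (DoubleBoundary A)) : Prop :=
  ∃ ψ, FixesSingularity φ ψ Ω

/-! ### Completed interval exchange transformations and Rauzy induction -/

/-- The largest position `N - 1`, where `N` is the number of letters. -/
def lastPos (A : Type*) [Fintype A] [Nontrivial A] : Fin (Fintype.card A) :=
  ⟨Fintype.card A - 1, Nat.sub_lt Fintype.card_pos one_pos⟩

/-- The positions `π'` obtained from `π` by moving the last letter `b = π⁻¹(N - 1)` to the position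
just after `a`: `π'(c) = π(c)` if `π(c) ≤ π(a)`, `π'(b) = π(a) + 1`, and `π'(c) = π(c) + 1` if
`π(a) < π(c) < π(b)`. (If `a = b`, then `π' = π`.) -/
def moveLastFun {A : Type*} [Fintype A] [DecidableEq A] [Nontrivial A]
    (π : A ≃ Fin (Fintype.card A)) (a c : A) : Fin (Fintype.card A) :=
  if h : π c ≤ π a then π c
  else if hb : π c = lastPos A then
    ⟨π a + 1, by have := (π c).2; have : (π a : ℕ) < π c := not_le.mp h; omega⟩
  else
    ⟨π c + 1, by
      have h1 := (π c).2
      have h2 : (π c : ℕ) ≠ Fintype.card A - 1 := fun e => hb (Fin.ext e)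
      omega⟩

theorem moveLastFun_val {A : Type*} [Fintype A] [DecidableEq A] [Nontrivial A]
    (π : A ≃ Fin (Fintype.card A)) (a c : A) :
    (moveLastFun π a c : ℕ) = if (π c : ℕ) ≤ π a then (π c : ℕ)
      else if (π c : ℕ) = Fintype.card A - 1 then (π a : ℕ) + 1 else (π c : ℕ) + 1 := by
  have hl : (lastPos A : ℕ) = Fintype.card A - 1 := rfl
  unfold moveLastFun
  by_cases h : π c ≤ π a
  · rw [dif_pos h, if_pos (Fin.le_def.mp h)]
  · rw [dif_neg h, if_neg (fun e => h (Fin.le_def.mpr e))]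
    by_cases hb : π c = lastPos A
    · rw [dif_pos hb, if_pos (by rw [hb, hl])]
    · rw [dif_neg hb, if_neg (fun e => hb (Fin.ext (e.trans hl.symm)))]

theorem moveLastFun_injective {A : Type*} [Fintype A] [DecidableEq A] [Nontrivial A]
    (π : A ≃ Fin (Fintype.card A)) (a : A) : Function.Injective (moveLastFun π a) := by
  intro c d hcd
  apply π.injective
  have hc := (π c).2
  have hd := (π d).2
  apply Fin.ext
  have h := congrArg Fin.val hcd
  rw [moveLastFun_val, moveLastFun_val] at h
  split_ifs at h <;> omega

/-- The bijection given by `moveLastFun`. -/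
noncomputable def moveLast {A : Type*} [Fintype A] [DecidableEq A] [Nontrivial A]
    (π : A ≃ Fin (Fintype.card A)) (a : A) : A ≃ Fin (Fintype.card A) :=
  Equiv.ofBijective (moveLastFun π a)
    ((Fintype.bijective_iff_injective_and_card _).mpr
      ⟨moveLastFun_injective π a, (Fintype.card_fin _).symm⟩)

/-- A completed interval exchange transformation `δ = (π, λ)` on the alphabet `A`, with
`N ≥ 2` letters: a pair `π = (π₀, π₁)` of bijections onto `{0, …, N - 1}` and a vector `λ` of positive
lengths. -/
structure CIET (A : Type*) [Fintype A] where
  pos0 : A ≃ Fin (Fintype.card A)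
  pos1 : A ≃ Fin (Fintype.card A)
  len : A → ℝ
  len_pos : ∀ a, 0 < len a

namespace CIET

variable {A : Type*} [Fintype A]

/-- `Λ₀(a)`, the sum of the lengths of the letters `b` with `π₀(b) < π₀(a)`. -/
noncomputable def left0 (δ : CIET A) (a : A) : ℝ := ∑ b with δ.pos0 b < δ.pos0 a, δ.len b

/-- `Λ₁(a)`, the sum of the lengths of the letters `b` with `π₁(b) < π₁(a)`. -/
noncomputable def left1 (δ : CIET A) (a : A) : ℝ := ∑ b with δ.pos1 b < δ.pos1 a, δ.len b

/-- The domain `[Λ₀(a), Λ₀(a) + λ_a]` of the partial isometry `δ_a`. -/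
noncomputable def domain (δ : CIET A) (a : A) : Set ℝ :=
  Set.Icc (δ.left0 a) (δ.left0 a + δ.len a)

/-- The partial isometry `δ_a`, to be used on `δ.domain a`: `x ↦ x - Λ₀(a) + Λ₁(a)`. The system
`{δ_a}` is the dynamics that the pair `(π, λ)` encodes. -/
noncomputable def isometry (δ : CIET A) (a : A) (x : ℝ) : ℝ := x - δ.left0 a + δ.left1 a

variable [DecidableEq A] [Nontrivial A]

/-- `α₀ = π₀⁻¹(N - 1)`. -/
def last0 (δ : CIET A) : A := δ.pos0.symm (lastPos A)

/-- `α₁ = π₁⁻¹(N - 1)`. -/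
def last1 (δ : CIET A) : A := δ.pos1.symm (lastPos A)

/-- The Rauzy induction of `δ` is defined. -/
def HasRauzy (δ : CIET A) : Prop := δ.len δ.last0 ≠ δ.len δ.last1

open Classical in
/-- The completed Rauzy induction `R(δ)`; type `0` if `λ_{α₀} > λ_{α₁}`, and type `1`
if `λ_{α₀} < λ_{α₁}`. The value for `λ_{α₀} = λ_{α₁}` is a placeholder, which `IsReturnTime`
excludes. -/
noncomputable def rauzy (δ : CIET A) : CIET A :=
  if h0 : δ.len δ.last1 < δ.len δ.last0 then
    { pos0 := δ.pos0
      pos1 := moveLast δ.pos1 δ.last0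
      len := fun a => if a = δ.last0 then δ.len δ.last0 - δ.len δ.last1 else δ.len a
      len_pos := fun a => by
        split_ifs
        · exact sub_pos.mpr h0
        · exact δ.len_pos a }
  else if h1 : δ.len δ.last0 < δ.len δ.last1 then
    { pos0 := moveLast δ.pos0 δ.last1
      pos1 := δ.pos1
      len := fun a => if a = δ.last1 then δ.len δ.last1 - δ.len δ.last0 else δ.len a
      len_pos := fun a => by
        split_ifs
        · exact sub_pos.mpr h1
        · exact δ.len_pos a }
  else δ


end CIET

/-- The endomorphism of the free group that sends the generator `a` to `g` and fixes all the other
generators. -/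
def sendGen {A : Type*} [DecidableEq A] (a : A) (g : FreeGroup A) : FreeGroup A →* FreeGroup A :=
  FreeGroup.lift fun c => if c = a then g else FreeGroup.of c

/-- The automorphism of the free group that sends `a` to `a b` and fixes all the other
generators, for `b ≠ a`. -/
def rightTwist {A : Type*} [DecidableEq A] (a b : A) (h : b ≠ a) : MulAut (FreeGroup A) :=
  MonoidHom.toMulEquiv (sendGen a (FreeGroup.of a * FreeGroup.of b))
    (sendGen a (FreeGroup.of a * (FreeGroup.of b)⁻¹))
    (by ext c; by_cases hc : c = a <;> simp [sendGen, hc, h])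
    (by ext c; by_cases hc : c = a <;> simp [sendGen, hc, h])

/-- The automorphism of the free group that sends `a` to `b a` and fixes all the other
generators, for `b ≠ a`. -/
def leftTwist {A : Type*} [DecidableEq A] (a b : A) (h : b ≠ a) : MulAut (FreeGroup A) :=
  MonoidHom.toMulEquiv (sendGen a (FreeGroup.of b * FreeGroup.of a))
    (sendGen a ((FreeGroup.of b)⁻¹ * FreeGroup.of a))
    (by ext c; by_cases hc : c = a <;> simp [sendGen, hc, h])
    (by ext c; by_cases hc : c = a <;> simp [sendGen, hc, h])

namespace CIET

variable {A : Type*} [Fintype A] [DecidableEq A] [Nontrivial A]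

open Classical in
/-- The Dehn twist `σ` associated with the Rauzy induction of `δ`: it sends `α₁` to `α₁ α₀` if `δ`
has type `0`, it sends `α₀` to `α₁ α₀` if `δ` has type `1`, and it fixes all the other
generators. (As for `rauzy`, there is a placeholder for `λ_{α₀} = λ_{α₁}`.) -/
noncomputable def dehnTwist (δ : CIET A) : MulAut (FreeGroup A) :=
  if h0 : δ.len δ.last1 < δ.len δ.last0 then
    rightTwist δ.last1 δ.last0 (fun e => h0.ne (by rw [e]))
  else if h1 : δ.len δ.last0 < δ.len δ.last1 then
    leftTwist δ.last0 δ.last1 (fun e => h1.ne (by rw [e]))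
  else 1

/-- `n` is a positive integer for which `Rⁿ(δ)` is defined and equal to `(π, η λ)` for
some real number `η > 0`, where `δ = (π, λ)`. -/
def IsReturnTime (δ : CIET A) (n : ℕ) : Prop :=
  1 ≤ n ∧ (∀ i < n, HasRauzy (rauzy^[i] δ)) ∧
    (rauzy^[n] δ).pos0 = δ.pos0 ∧ (rauzy^[n] δ).pos1 = δ.pos1 ∧
    ∃ η : ℝ, 0 < η ∧ ∀ a, (rauzy^[n] δ).len a = η * δ.len a

/-- `δ` is self-induced. -/
def IsSelfInduced (δ : CIET A) : Prop := ∃ n, IsReturnTime δ n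

open Classical in
/-- The `δ`-automorphism `σ₀ ∘ σ₁ ∘ ⋯ ∘ σₙ₋₁` of a self-induced `δ`, where `n` is the least positive
integer with `Rⁿ(δ) = (π, η λ)`, and `σᵢ` is the Dehn twist associated with the induction
from `Rⁱ(δ)` to `Rⁱ⁺¹(δ)`. -/
noncomputable def deltaAutomorphism (δ : CIET A) (h : δ.IsSelfInduced) : MulAut (FreeGroup A) :=
  ((List.range (Nat.find h)).map fun i => dehnTwist (rauzy^[i] δ)).prod

end CIET

/-! Let η be the ratio of the self-induction and τ(g) the translation length `transl` attached to a
word g. Composing the Rauzy steps (`RauzyStep.induces`, `exists_selfInduces`) yields three facts.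
The automorphism φ maps an itinerary of constant sign of a point x to an itinerary of ηx; τ(φ(g)) =
η τ(g); and for each left endpoint x of a piece, some word p of constant sign, followed by a whole
neighbourhood of ηx, leads from ηx back to x.

Each finite window of a line of the attracting subshift is followed by a nondegenerate interval
(`admissible_of_mem_attractingSubshift`). If i_w ∘ φᵏ fixes such a line, then y ↦ ηᵏ y + τ(w)
preserves the set of points that code the line. This set is closed, and nonempty by compactness, and
the map is a contraction, so its fixed point x codes the line. As the windows are nondegenerate
intervals around or beside x, the line is a limit of codings from the right or from the left of x
(`sideCoded_of_mapsTo`). A point together with a side determines the line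
(`SideCoded.ext_of_oriented`). Since x depends only on w and k, the singularity Ω consists of
exactly two lines, one for each side of x.

By condition (iii), two distinct closed pieces of the same sign meet at x, so x is a left endpoint
of a piece; let p be its word. Then φ sends the line coded by x on a given side to the line coded by
ηx on the same side, and p brings it back to x. By uniqueness i_p ∘ φ fixes both lines
(`mapsTo_of_sideCoded`). Conversely, a line of the subshift fixed by a power of i_p ∘ φ is again
coded by x on one side (`exists_conjugacy_mul_pow`), hence lies in Ω. -/

/-! ### Words of constant sign -/

/-- All the letters of the reduced word `g` have sign `e`. -/
def IsSigned {A : Type*} [DecidableEq A] (e : Bool) (g : FreeGroup A) : Prop :=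
  ∀ l ∈ g.toWord, l.2 = e

section Words

variable {A : Type*}

theorem letterInv_snd (l : A × Bool) : (letterInv l).2 = !l.2 := rfl

theorem mk_letterInv (l : A × Bool) :
    FreeGroup.mk [letterInv l] = (FreeGroup.mk [l])⁻¹ := by
  simp [FreeGroup.inv_mk, FreeGroup.invRev, letterInv]

theorem mk_cons (l : A × Bool) (L : List (A × Bool)) :
    FreeGroup.mk (l :: L) = FreeGroup.mk [l] * FreeGroup.mk L := by
  simp [FreeGroup.mul_mk]

theorem ne_letterInv_iff {l c : A × Bool} : c ≠ letterInv l ↔ (l.1 = c.1 → l.2 = c.2) := by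
  rcases l with ⟨a, b⟩
  rcases c with ⟨a', b'⟩
  cases b <;> cases b' <;> simp [letterInv, eq_comm]

theorem isReduced_of_signed {e : Bool} {L : List (A × Bool)} (h : ∀ l ∈ L, l.2 = e) :
    FreeGroup.IsReduced L := by
  apply List.Pairwise.isChain
  apply List.pairwise_of_forall_mem_list
  intro a ha b hb _
  rw [h a ha, h b hb]

variable [DecidableEq A]

theorem toWord_mk_of_signed {e : Bool} {L : List (A × Bool)} (h : ∀ l ∈ L, l.2 = e) :
    (FreeGroup.mk L).toWord = L := by
  rw [FreeGroup.toWord_mk, (isReduced_of_signed h).reduce_eq]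

theorem isSigned_mk {e : Bool} {L : List (A × Bool)} (h : ∀ l ∈ L, l.2 = e) :
    IsSigned e (FreeGroup.mk L) := by
  intro l hl
  rw [toWord_mk_of_signed h] at hl
  exact h l hl

theorem isSigned_one (e : Bool) : IsSigned e (1 : FreeGroup A) := by
  intro l hl
  simp at hl

theorem isSigned_letter (l : A × Bool) : IsSigned l.2 (FreeGroup.mk [l]) :=
  isSigned_mk (by simp)

namespace IsSigned

variable {e : Bool} {g h : FreeGroup A}

theorem toWord_mul (hg : IsSigned e g) (hh : IsSigned e h) :
    (g * h).toWord = g.toWord ++ h.toWord := by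
  rw [FreeGroup.toWord_mul]
  apply FreeGroup.IsReduced.reduce_eq
  apply isReduced_of_signed (e := e)
  intro l hl
  rcases List.mem_append.mp hl with hl | hl
  · exact hg l hl
  · exact hh l hl

theorem mul (hg : IsSigned e g) (hh : IsSigned e h) : IsSigned e (g * h) := by
  intro l hl
  rw [toWord_mul hg hh] at hl
  rcases List.mem_append.mp hl with hl | hl
  · exact hg l hl
  · exact hh l hl

theorem inv (hg : IsSigned e g) : IsSigned (!e) g⁻¹ := by
  intro l hl
  rw [FreeGroup.toWord_inv] at hl
  simp only [FreeGroup.invRev, List.mem_reverse, List.mem_map] at hl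
  obtain ⟨c, hc, rfl⟩ := hl
  simp [hg c hc]

theorem list_prod {L : List (FreeGroup A)} (hL : ∀ g ∈ L, IsSigned e g) :
    IsSigned e L.prod := by
  induction L with
  | nil => exact isSigned_one e
  | cons g L ih =>
    rw [List.prod_cons]
    exact (hL g (by simp)).mul (ih fun g hg => hL g (by simp [hg]))

end IsSigned

/-- An automorphism that maps words of constant sign to words of the same sign that are at
least as long. -/
def PreservesSign (φ : MulAut (FreeGroup A)) : Prop :=
  ∀ e g, IsSigned e g → IsSigned e (φ g) ∧ g.toWord.length ≤ (φ g).toWord.length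

theorem preservesSign_one : PreservesSign (1 : MulAut (FreeGroup A)) :=
  fun _ _ hg => ⟨hg, le_rfl⟩

theorem PreservesSign.mul {φ ψ : MulAut (FreeGroup A)} (hφ : PreservesSign φ)
    (hψ : PreservesSign ψ) : PreservesSign (φ * ψ) := fun e g hg =>
  ⟨(hφ e _ (hψ e g hg).1).1, (hψ e g hg).2.trans (hφ e _ (hψ e g hg).1).2⟩

theorem PreservesSign.pow {φ : MulAut (FreeGroup A)} (hφ : PreservesSign φ) (k : ℕ) :
    PreservesSign (φ ^ k) := by
  induction k with
  | zero => exact preservesSign_one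
  | succ k ih => rw [pow_succ]; exact ih.mul hφ

/-- Images of letters of the same sign multiply without cancellation, so the lengths add up. -/
theorem PreservesSign.of_letters {φ : MulAut (FreeGroup A)}
    (h : ∀ l : A × Bool, IsSigned l.2 (φ (FreeGroup.mk [l])) ∧
      1 ≤ (φ (FreeGroup.mk [l])).toWord.length) : PreservesSign φ := by
  intro e g hg
  rw [← FreeGroup.mk_toWord (x := g), toWord_mk_of_signed hg]
  unfold IsSigned at hg
  generalize g.toWord = L at hg
  induction L with
  | nil => exact ⟨by rw [← FreeGroup.one_eq_mk, map_one]; exact isSigned_one e, by simp⟩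
  | cons l L ih =>
    have hl : l.2 = e := hg l (by simp)
    obtain ⟨h1, h2⟩ := ih fun l hl => hg l (by simp [hl])
    obtain ⟨h3, h4⟩ := h l
    rw [hl] at h3
    rw [mk_cons, _root_.map_mul]
    refine ⟨h3.mul h1, ?_⟩
    rw [h3.toWord_mul h1, List.length_append, List.length_cons]
    omega

/-! ### Multiplication of a reduced word by one letter -/

theorem toWord_mk_mul_of_head {l : A × Bool} {g : FreeGroup A} {t : List (A × Bool)}
    (h : g.toWord = letterInv l :: t) : (FreeGroup.mk [l] * g).toWord = t := by
  have hr : FreeGroup.IsReduced t :=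
    FreeGroup.isReduced_toWord.infix (L₂ := g.toWord) ⟨[letterInv l], [], by simp [h]⟩
  have : FreeGroup.mk [l] * g = FreeGroup.mk t := by
    rw [← FreeGroup.mk_toWord (x := g), h, mk_cons (letterInv l), mk_letterInv,
      mul_inv_cancel_left]
  rw [this, FreeGroup.toWord_mk, hr.reduce_eq]

theorem toWord_mk_mul_of_head_ne {l : A × Bool} {g : FreeGroup A}
    (h : g.toWord[0]? ≠ some (letterInv l)) :
    (FreeGroup.mk [l] * g).toWord = l :: g.toWord := by
  have : FreeGroup.mk [l] * g = FreeGroup.mk (l :: g.toWord) := by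
    rw [mk_cons l g.toWord, FreeGroup.mk_toWord]
  rw [this, FreeGroup.toWord_mk]
  apply FreeGroup.IsReduced.reduce_eq
  have hr : FreeGroup.IsReduced g.toWord := FreeGroup.isReduced_toWord
  cases hg : g.toWord with
  | nil => exact FreeGroup.IsReduced.singleton
  | cons c t =>
    rw [hg] at hr h
    refine FreeGroup.isReduced_cons_cons.mpr ⟨ne_letterInv_iff.mp ?_, hr⟩
    intro e
    exact h (by simp [e])

/-- Multiplying by a letter on the right either deletes the last letter or appends one. This is why
right factors do not affect limits in the boundary. -/
theorem getElem?_toWord_mul_mk {l : A × Bool} {g : FreeGroup A} {i : ℕ}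
    (hi : i + 1 < g.toWord.length) :
    (g * FreeGroup.mk [l]).toWord[i]? = g.toWord[i]? := by
  have hr : FreeGroup.IsReduced g.toWord := FreeGroup.isReduced_toWord
  rcases List.eq_nil_or_concat g.toWord with h | ⟨M, c, h⟩
  · simp [h] at hi
  rw [List.concat_eq_append] at h
  have hi' : i < M.length := by simpa [h] using hi
  have hg : g = FreeGroup.mk M * FreeGroup.mk [c] := by
    rw [FreeGroup.mul_mk, ← h, FreeGroup.mk_toWord]
  rw [h] at hr
  by_cases hc : c = letterInv l
  · have : g * FreeGroup.mk [l] = FreeGroup.mk M := by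
      rw [hg, hc, mk_letterInv, inv_mul_cancel_right]
    rw [this, FreeGroup.toWord_mk,
      (hr.infix ⟨[], [c], by simp⟩ : FreeGroup.IsReduced M).reduce_eq, h,
      List.getElem?_append_left hi']
  · have h2 : FreeGroup.IsReduced ([c] ++ [l]) := by
      refine FreeGroup.isReduced_cons_cons.mpr ⟨ne_letterInv_iff.mp ?_, FreeGroup.IsReduced.singleton⟩
      intro e
      exact hc (by rw [e, letterInv_letterInv])
    have : g * FreeGroup.mk [l] = FreeGroup.mk (M ++ [c] ++ [l]) := by
      rw [hg, FreeGroup.mul_mk, FreeGroup.mul_mk]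
    rw [this, FreeGroup.toWord_mk, (hr.append_overlap h2 (by simp)).reduce_eq, h,
      List.getElem?_append_left (by simp; omega)]

end Words

/-! ### The action of the free group on its boundary -/

namespace FreeBoundary

variable {A : Type*} [DecidableEq A]

/-- The bijection of the boundary given by multiplication by a letter. -/
def letterEquiv (l : A × Bool) : Equiv.Perm (FreeBoundary A) where
  toFun := letterMul l
  invFun := letterMul (letterInv l)
  left_inv := letterMul_letterInv l
  right_inv V := by
    have := letterMul_letterInv (letterInv l) V
    rwa [letterInv_letterInv] at this

/-- The action of the free group on its boundary. -/
def act : FreeGroup A →* Equiv.Perm (FreeBoundary A) :=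
  FreeGroup.lift fun a => letterEquiv (a, true)

theorem act_letter (l : A × Bool) (V : FreeBoundary A) :
    act (FreeGroup.mk [l]) V = letterMul l V := by
  rcases l with ⟨a, b⟩
  cases b
  · have : FreeGroup.mk [(a, false)] = (FreeGroup.of a)⁻¹ := by
      simp [FreeGroup.of, FreeGroup.inv_mk, FreeGroup.invRev]
    rw [this, map_inv, act, FreeGroup.lift_apply_of]
    rfl
  · change act (FreeGroup.of a) V = _
    rw [act, FreeGroup.lift_apply_of]
    rfl

theorem act_cons (l : A × Bool) (L : List (A × Bool)) (V : FreeBoundary A) :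
    act (FreeGroup.mk (l :: L)) V = letterMul l (act (FreeGroup.mk L) V) := by
  rw [mk_cons, map_mul, Equiv.Perm.mul_apply, act_letter]

theorem act_inv_act (g : FreeGroup A) (V : FreeBoundary A) : act g⁻¹ (act g V) = V := by
  rw [← Equiv.Perm.mul_apply, ← map_mul, inv_mul_cancel, map_one, Equiv.Perm.one_apply]

theorem letterMul_of_eq {l : A × Bool} {V : FreeBoundary A} (h : V.letter 0 = letterInv l) (i : ℕ) :
    (letterMul l V).letter i = V.letter (i + 1) := by
  simp [letterMul, h]

theorem letterMul_zero_of_ne {l : A × Bool} {V : FreeBoundary A} (h : V.letter 0 ≠ letterInv l) :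
    (letterMul l V).letter 0 = l := by
  simp [letterMul, h]

theorem letterMul_succ_of_ne {l : A × Bool} {V : FreeBoundary A} (h : V.letter 0 ≠ letterInv l)
    (i : ℕ) : (letterMul l V).letter (i + 1) = V.letter i := by
  simp [letterMul, h]

/-- Without cancellation at the junction, the first letter does not depend on `V`. In
`exists_window_act` this would give both ends of a line the same first letter. -/
theorem act_letter_zero {L : List (A × Bool)} {m l : A × Bool} {V : FreeBoundary A}
    (hL : FreeGroup.IsReduced (m :: L)) (hl : (m :: L).getLast? = some l)
    (hV : V.letter 0 ≠ letterInv l) : (act (FreeGroup.mk (m :: L)) V).letter 0 = m := by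
  induction L generalizing m with
  | nil =>
    obtain rfl : m = l := by simpa using hl
    rw [act_letter]
    exact letterMul_zero_of_ne hV
  | cons c L ih =>
    obtain ⟨h1, h2⟩ := FreeGroup.isReduced_cons_cons.mp hL
    have h3 := ih h2 (by simpa using hl)
    rw [act_cons]
    apply letterMul_zero_of_ne
    rw [h3]
    exact ne_letterInv_iff.mpr h1

/-! ### Limits in the boundary -/

theorem IsLimit.unique {g : ℕ → FreeGroup A} {V W : FreeBoundary A} (hV : IsLimit g V)
    (hW : IsLimit g W) : V = W := by
  ext1
  funext i
  obtain ⟨n, h1, h2⟩ := ((hV i).and (hW i)).exists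
  exact Option.some_injective _ (h1.symm.trans h2)

theorem IsLimit.letter_mul {g : ℕ → FreeGroup A} {V : FreeBoundary A} (h : IsLimit g V)
    (l : A × Bool) : IsLimit (fun n => FreeGroup.mk [l] * g n) (letterMul l V) := by
  by_cases hV : V.letter 0 = letterInv l
  · intro i
    filter_upwards [h 0, h (i + 1)] with n h0 hi
    cases hg : (g n).toWord with
    | nil => simp [hg] at h0
    | cons c t =>
      have hc : c = letterInv l := by simpa [hg, hV] using h0
      rw [toWord_mk_mul_of_head (hg.trans (by rw [hc])), letterMul_of_eq hV]
      simpa [hg] using hi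
  · intro i
    cases i with
    | zero =>
      filter_upwards [h 0] with n h0
      rw [toWord_mk_mul_of_head_ne (by rw [h0]; simpa using hV), letterMul_zero_of_ne hV]
      simp
    | succ i =>
      filter_upwards [h 0, h i] with n h0 hi
      rw [toWord_mk_mul_of_head_ne (by rw [h0]; simpa using hV), letterMul_succ_of_ne hV]
      simpa using hi

theorem IsLimit.mul_left {g : ℕ → FreeGroup A} {V : FreeBoundary A} (h : IsLimit g V)
    (w : FreeGroup A) : IsLimit (fun n => w * g n) (act w V) := by
  rw [← FreeGroup.mk_toWord (x := w)]
  induction w.toWord with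
  | nil => simpa [← FreeGroup.one_eq_mk] using h
  | cons l L ih =>
    rw [act_cons]
    convert ih.letter_mul l using 2 with n
    rw [mk_cons, mul_assoc]

theorem IsLimit.mul_letter {g : ℕ → FreeGroup A} {V : FreeBoundary A} (h : IsLimit g V)
    (l : A × Bool) : IsLimit (fun n => g n * FreeGroup.mk [l]) V := by
  intro i
  filter_upwards [h i, h (i + 1)] with n h0 h1
  rw [getElem?_toWord_mul_mk, h0]
  by_contra hn
  rw [List.getElem?_eq_none (by omega)] at h1
  simp at h1

theorem IsLimit.mul_right {g : ℕ → FreeGroup A} {V : FreeBoundary A} (h : IsLimit g V)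
    (w : FreeGroup A) : IsLimit (fun n => g n * w) V := by
  rw [← FreeGroup.mk_toWord (x := w)]
  generalize w.toWord = L
  induction L generalizing g with
  | nil => simpa [← FreeGroup.one_eq_mk] using h
  | cons l L ih =>
    convert ih (h.mul_letter l) using 2 with n
    rw [mk_cons, mul_assoc]

/-- The right factor `w` of the conjugate disappears in the limit, and the left factor acts on the
limit. -/
theorem mapsTo_conjugacy_mul_iff {φ : MulAut (FreeGroup A)} {w : FreeGroup A}
    {V W : FreeBoundary A} : MapsTo (conjugacy w * φ) V W ↔ MapsTo φ V (act w W) := by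
  constructor
  · intro h
    have h1 := (IsLimit.mul_right h w⁻¹).mul_left w
    have h2 : (fun n => w * ((conjugacy w * φ) (V.initial n) * w⁻¹)) =
        fun n => φ (V.initial n) := by
      funext n
      simp [conjugacy, mul_assoc]
    rwa [h2] at h1
  · intro h
    have h1 := (IsLimit.mul_right h w).mul_left w⁻¹
    have h2 : (fun n => w⁻¹ * (φ (V.initial n) * w)) =
        fun n => (conjugacy w * φ) (V.initial n) := by
      funext n
      simp [conjugacy, mul_assoc]
    rwa [h2, act_inv_act] at h1

/-! ### Images of rays of constant sign -/

/-- The word `V₀ ⋯ Vₙ₋₁`. -/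
def pre (V : FreeBoundary A) (n : ℕ) : List (A × Bool) := (List.range n).map V.letter

omit [DecidableEq A] in
theorem pre_length (V : FreeBoundary A) (n : ℕ) : (V.pre n).length = n := by simp [pre]

omit [DecidableEq A] in
theorem pre_succ (V : FreeBoundary A) (n : ℕ) : V.pre (n + 1) = V.pre n ++ [V.letter n] := by
  simp [pre, List.range_succ]

omit [DecidableEq A] in
theorem pre_getElem? (V : FreeBoundary A) {n i : ℕ} (h : i < n) :
    (V.pre n)[i]? = some (V.letter i) := by simp [pre, h]

omit [DecidableEq A] in
theorem pre_prefix (V : FreeBoundary A) {m n : ℕ} (h : m ≤ n) : V.pre m <+: V.pre n := by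
  induction n, h using Nat.le_induction with
  | base => exact List.prefix_refl _
  | succ n _ ih => rw [pre_succ]; exact ih.trans (List.prefix_append _ _)

theorem letterMul_pre_of_eq {l : A × Bool} {V : FreeBoundary A} (h : V.letter 0 = letterInv l)
    (n : ℕ) : V.pre (n + 1) = letterInv l :: (letterMul l V).pre n := by
  simp only [pre, List.range_succ_eq_map, List.map_cons, List.map_map, h]
  congr 1
  apply List.map_congr_left
  intro i _
  exact (letterMul_of_eq h i).symm

theorem letterMul_pre_of_ne {l : A × Bool} {V : FreeBoundary A} (h : V.letter 0 ≠ letterInv l)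
    (n : ℕ) : (letterMul l V).pre (n + 1) = l :: V.pre n := by
  simp only [pre, List.range_succ_eq_map, List.map_cons, List.map_map, letterMul_zero_of_ne h]
  congr 1
  apply List.map_congr_left
  intro i _
  exact letterMul_succ_of_ne h i

theorem IsLimit.eventually_pre_prefix {g : ℕ → FreeGroup A} {V : FreeBoundary A}
    (h : IsLimit g V) (n : ℕ) : ∀ᶠ m in Filter.atTop, V.pre n <+: (g m).toWord := by
  have : ∀ᶠ m in Filter.atTop, ∀ i ∈ Finset.range n, (g m).toWord[i]? = some (V.letter i) :=
    (Filter.eventually_all_finset _).mpr fun i _ => h i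
  filter_upwards [this] with m hm
  rw [List.prefix_iff_getElem?]
  intro i hi
  rw [pre_length] at hi
  rw [hm i (Finset.mem_range.mpr hi)]
  simp [pre]

/-- All the letters of the ray `V` have sign `e`. -/
def Signed (e : Bool) (V : FreeBoundary A) : Prop := ∀ i, (V.letter i).2 = e

omit [DecidableEq A] in
theorem Signed.mem_pre {e : Bool} {V : FreeBoundary A} (h : V.Signed e) {n : ℕ} {l : A × Bool}
    (hl : l ∈ V.pre n) : l.2 = e := by
  simp only [pre, List.mem_map] at hl
  obtain ⟨i, _, rfl⟩ := hl
  exact h i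

theorem Signed.toWord_initial {e : Bool} {V : FreeBoundary A} (h : V.Signed e) (n : ℕ) :
    (V.initial n).toWord = V.pre n :=
  toWord_mk_of_signed fun _ hl => h.mem_pre hl

theorem Signed.isSigned_initial {e : Bool} {V : FreeBoundary A} (h : V.Signed e) (n : ℕ) :
    IsSigned e (V.initial n) :=
  isSigned_mk fun _ hl => h.mem_pre hl

omit [DecidableEq A] in
theorem initial_succ (V : FreeBoundary A) (n : ℕ) :
    V.initial (n + 1) = V.initial n * FreeGroup.mk [V.letter n] := by
  exact (congrArg FreeGroup.mk (pre_succ V n)).trans FreeGroup.mul_mk.symm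

theorem IsLimit.signed {e : Bool} {g : ℕ → FreeGroup A} {V : FreeBoundary A} (h : IsLimit g V)
    (hg : ∀ n, IsSigned e (g n)) : V.Signed e := by
  intro i
  obtain ⟨n, hn⟩ := (h i).exists
  exact hg n _ (List.mem_of_getElem? hn)

/-- The image of a ray of constant sign under an automorphism that preserves signs. -/
theorem exists_mapsTo {φ : MulAut (FreeGroup A)} (hφ : PreservesSign φ) {e : Bool}
    {V : FreeBoundary A} (hV : V.Signed e) :
    ∃ W : FreeBoundary A, W.Signed e ∧ MapsTo φ V W := by
  have hs (n) := (hφ e _ (hV.isSigned_initial n)).1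
  have hlen (n) : n ≤ (φ (V.initial n)).toWord.length := by
    have := (hφ e _ (hV.isSigned_initial n)).2
    rwa [hV.toWord_initial, pre_length] at this
  have hpre : ∀ m n, m ≤ n → (φ (V.initial m)).toWord <+: (φ (V.initial n)).toWord := by
    intro m n hmn
    induction n, hmn using Nat.le_induction with
    | base => exact List.prefix_refl _
    | succ n _ ih =>
      have h1 : IsSigned e (φ (FreeGroup.mk [V.letter n])) :=
        (hφ e _ (by simpa [hV n] using isSigned_letter (V.letter n))).1
      rw [initial_succ, _root_.map_mul, (hs n).toWord_mul h1]
      exact ih.trans (List.prefix_append _ _)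
  -- The images of the initial words form a chain of prefixes, the `n`-th of length at least `n`, so
  -- the letter `i` is settled from `n = i + 1` on.
  let c : ℕ → A × Bool := fun i => (φ (V.initial (i + 1))).toWord[i]'(hlen (i + 1))
  have hc : ∀ i, (c i).2 = e := fun i => hs (i + 1) _ (List.getElem_mem _)
  refine ⟨⟨c, fun i h => ?_⟩, hc, fun i => ?_⟩
  · have := congrArg Prod.snd h
    rw [letterInv_snd, hc, hc] at this
    simp at this
  · filter_upwards [Filter.eventually_ge_atTop (i + 1)] with n hn
    rw [(List.prefix_iff_getElem?.mp (hpre _ _ hn)) i (hlen (i + 1))]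

end FreeBoundary

/-! ### Partial sums of lengths -/

section LeftSum

variable {A : Type*} [Fintype A]

/-- The sum of the lengths of the letters placed before `a`. -/
noncomputable def leftSum (π : A ≃ Fin (Fintype.card A)) (len : A → ℝ) (a : A) : ℝ :=
  ∑ b with π b < π a, len b

theorem leftSum_add_len (π : A ≃ Fin (Fintype.card A)) (len : A → ℝ) (a : A) :
    leftSum π len a + len a = ∑ b with π b ≤ π a, len b := by
  classical
  have : Finset.univ.filter (fun b => π b ≤ π a) =
      insert a (Finset.univ.filter fun b => π b < π a) := by
    ext b
    simp [le_iff_lt_or_eq, or_comm]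
  rw [this, Finset.sum_insert (by simp), leftSum, add_comm]

theorem leftSum_add_len_le {π : A ≃ Fin (Fintype.card A)} {len : A → ℝ} (h : ∀ a, 0 < len a)
    {a b : A} (hab : π a < π b) : leftSum π len a + len a ≤ leftSum π len b := by
  rw [leftSum_add_len]
  apply Finset.sum_le_sum_of_subset_of_nonneg
  · intro c
    simp only [Finset.mem_filter, Finset.mem_univ, true_and]
    exact fun hc => hc.trans_lt hab
  · exact fun c _ _ => (h c).le

variable [Nontrivial A]

theorem le_lastPos (i : Fin (Fintype.card A)) : i ≤ lastPos A :=
  Nat.le_sub_one_of_lt i.2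

theorem leftSum_add_len_last (π : A ≃ Fin (Fintype.card A)) (len : A → ℝ) :
    leftSum π len (π.symm (lastPos A)) + len (π.symm (lastPos A)) = ∑ b, len b := by
  rw [leftSum_add_len]
  congr 1
  ext b
  simp [le_lastPos]

theorem leftSum_congr_of_ne_last {π : A ≃ Fin (Fintype.card A)} {len len' : A → ℝ}
    (h : ∀ c, c ≠ π.symm (lastPos A) → len' c = len c) (a : A) :
    leftSum π len' a = leftSum π len a := by
  apply Finset.sum_congr rfl
  intro c hc
  apply h
  rintro rfl
  simp only [Finset.mem_filter, Equiv.apply_symm_apply] at hc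
  exact absurd hc.2 (not_lt.mpr (le_lastPos _))

variable [DecidableEq A]

theorem moveLast_val (π : A ≃ Fin (Fintype.card A)) (a c : A) :
    (moveLast π a c : ℕ) = if (π c : ℕ) ≤ π a then (π c : ℕ)
      else if (π c : ℕ) = Fintype.card A - 1 then (π a : ℕ) + 1 else (π c : ℕ) + 1 :=
  moveLastFun_val π a c

/-- Only `b` moves: inserted just after `a`, it fills exactly the length that `a` has lost, so the
letters further to the right keep their place. -/
theorem leftSum_moveLast {π : A ≃ Fin (Fintype.card A)} {len len' : A → ℝ} {a b : A}
    (hb : b = π.symm (lastPos A)) (hab : a ≠ b) (ha : len' a = len a - len b)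
    (h : ∀ c, c ≠ a → len' c = len c) (c : A) :
    leftSum (moveLast π a) len' c =
      if c = b then leftSum π len a + len a - len b else leftSum π len c := by
  have hπb : (π b : ℕ) = Fintype.card A - 1 := by rw [hb, Equiv.apply_symm_apply]; rfl
  have hlast : ∀ d, (π d : ℕ) ≤ Fintype.card A - 1 := fun d => le_lastPos (π d)
  have hne : ∀ d, d ≠ b → (π d : ℕ) ≠ Fintype.card A - 1 := fun d hd e =>
    hd (π.injective (Fin.ext (e.trans hπb.symm)))
  have hinj : ∀ d d', (π d : ℕ) = π d' → d = d' := fun d d' e => π.injective (Fin.ext e)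
  have hπa : (π a : ℕ) < Fintype.card A - 1 := lt_of_le_of_ne (hlast a) (hne a hab)
  have hsum : ∀ s : Finset A, a ∈ s → ∑ d ∈ s, len' d = ∑ d ∈ s, len d - len b := by
    intro s hs
    rw [← Finset.add_sum_erase s len' hs, ← Finset.add_sum_erase s len hs, ha,
      Finset.sum_congr rfl fun d hd => h d (Finset.ne_of_mem_erase hd)]
    ring
  have hsum' : ∀ s : Finset A, a ∉ s → ∑ d ∈ s, len' d = ∑ d ∈ s, len d := fun s hs =>
    Finset.sum_congr rfl fun d hd => h d fun e => hs (e ▸ hd)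
  have hmb : (moveLast π a b : ℕ) = π a + 1 := by
    rw [moveLast_val, if_neg (by omega), if_pos hπb]
  have hm1 : ∀ d, d ≠ b → (π d : ℕ) ≤ π a → (moveLast π a d : ℕ) = π d := fun d _ hd => by
    rw [moveLast_val, if_pos hd]
  have hm2 : ∀ d, d ≠ b → ¬ (π d : ℕ) ≤ π a → (moveLast π a d : ℕ) = π d + 1 := fun d hdb hd => by
    rw [moveLast_val, if_neg hd, if_neg (hne d hdb)]
  unfold leftSum
  split_ifs with hc
  · subst hc
    have hset : Finset.univ.filter (fun d => moveLast π a d < moveLast π a c) =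
        Finset.univ.filter (fun d => π d ≤ π a) := by
      ext d
      simp only [Finset.mem_filter, Finset.mem_univ, true_and, Fin.lt_def, Fin.le_def, hmb]
      by_cases hd : d = c
      · subst hd; omega
      · by_cases hd' : (π d : ℕ) ≤ π a
        · rw [hm1 d hd hd']; omega
        · rw [hm2 d hd hd']; omega
    rw [hset, hsum _ (by simp), ← leftSum_add_len]
    rfl
  · by_cases hca : (π c : ℕ) ≤ π a
    · have hset : Finset.univ.filter (fun d => moveLast π a d < moveLast π a c) =
          Finset.univ.filter (fun d => π d < π c) := by
        ext d
        simp only [Finset.mem_filter, Finset.mem_univ, true_and, Fin.lt_def, hm1 c hc hca]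
        by_cases hd : d = b
        · subst hd; omega
        · by_cases hd' : (π d : ℕ) ≤ π a
          · rw [hm1 d hd hd']
          · rw [hm2 d hd hd']; omega
      have han : a ∉ Finset.univ.filter (fun d => π d < π c) := by simpa using hca
      rw [hset, hsum' _ han]
    · have hset : Finset.univ.filter (fun d => moveLast π a d < moveLast π a c) =
          insert b (Finset.univ.filter (fun d => π d < π c)) := by
        ext d
        simp only [Finset.mem_filter, Finset.mem_univ, true_and, Fin.lt_def, hm2 c hc hca,
          Finset.mem_insert]
        by_cases hd : d = b
        · subst hd; rw [hmb]; simp; omega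
        · by_cases hd' : (π d : ℕ) ≤ π a
          · rw [hm1 d hd hd']; simp [hd]; omega
          · rw [hm2 d hd hd']; simp [hd]
      have hbn : b ∉ Finset.univ.filter (fun d => π d < π c) := by
        simp only [Finset.mem_filter, Finset.mem_univ, true_and, Fin.lt_def]
        have := hlast c
        omega
      rw [hset, hsum _ (by simpa [hab] using hca), Finset.sum_insert hbn]
      ring

end LeftSum

namespace CIET

/-! ### Words followed by a point -/

section Follows

variable {A : Type*} [Fintype A]

/-- The left endpoint of the domain of the partial isometry `δ_l`, for a letter `l`. -/
noncomputable def edge (δ : CIET A) (l : A × Bool) : ℝ :=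
  leftSum (bif l.2 then δ.pos0 else δ.pos1) δ.len l.1

/-- The domain of the partial isometry `δ_l`, for a letter `l`. -/
noncomputable def piece (δ : CIET A) (l : A × Bool) : Set ℝ :=
  Set.Icc (δ.edge l) (δ.edge l + δ.len l.1)

/-- The translation length of the partial isometry `δ_g`, as a homomorphism. -/
noncomputable def translHom (δ : CIET A) : FreeGroup A →* Multiplicative ℝ :=
  FreeGroup.lift fun a => Multiplicative.ofAdd (δ.edge (a, false) - δ.edge (a, true))

/-- The translation length of the partial isometry `δ_g`. -/
noncomputable def transl (δ : CIET A) (g : FreeGroup A) : ℝ := (δ.translHom g).toAdd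

theorem transl_one (δ : CIET A) : δ.transl 1 = 0 := by simp [transl]

theorem transl_mul (δ : CIET A) (g h : FreeGroup A) :
    δ.transl (g * h) = δ.transl g + δ.transl h := by simp [transl]

theorem transl_inv (δ : CIET A) (g : FreeGroup A) : δ.transl g⁻¹ = -δ.transl g := by
  simp [transl]

theorem transl_letter (δ : CIET A) (l : A × Bool) :
    δ.transl (FreeGroup.mk [l]) = δ.edge (letterInv l) - δ.edge l := by
  rcases l with ⟨a, b⟩
  have h : δ.transl (FreeGroup.of a) = δ.edge (a, false) - δ.edge (a, true) := by
    rw [transl, translHom, FreeGroup.lift_apply_of, toAdd_ofAdd]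
  cases b
  · have : FreeGroup.mk [(a, false)] = (FreeGroup.of a)⁻¹ := by
      simp [FreeGroup.of, FreeGroup.inv_mk, FreeGroup.invRev]
    rw [this, transl_inv, h]
    simp [letterInv]
  · exact h

/-- The word `L` is the itinerary of the point `x`: the partial isometries `δ_l`, for `l` in `L`,
can be applied successively to `x`. -/
def Follows (δ : CIET A) : List (A × Bool) → ℝ → Prop
  | [], _ => True
  | l :: L, x => x ∈ δ.piece l ∧ Follows δ L (x + δ.transl (FreeGroup.mk [l]))

theorem follows_nil (δ : CIET A) (x : ℝ) : δ.Follows [] x := trivial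

theorem follows_cons {δ : CIET A} {l : A × Bool} {L : List (A × Bool)} {x : ℝ} :
    δ.Follows (l :: L) x ↔ x ∈ δ.piece l ∧ δ.Follows L (x + δ.transl (FreeGroup.mk [l])) := Iff.rfl

theorem follows_singleton {δ : CIET A} {l : A × Bool} {x : ℝ} :
    δ.Follows [l] x ↔ x ∈ δ.piece l := by
  simp [Follows]

theorem follows_append {δ : CIET A} {L M : List (A × Bool)} {x : ℝ} :
    δ.Follows (L ++ M) x ↔ δ.Follows L x ∧ δ.Follows M (x + δ.transl (FreeGroup.mk L)) := by
  induction L generalizing x with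
  | nil => simp [Follows, ← FreeGroup.one_eq_mk, transl_one]
  | cons l L ih =>
    rw [List.cons_append, follows_cons, ih, follows_cons, mk_cons l L, transl_mul, and_assoc,
      add_assoc]

theorem Follows.of_prefix {δ : CIET A} {L M : List (A × Bool)} {x : ℝ} (h : δ.Follows M x)
    (hLM : L <+: M) : δ.Follows L x := by
  obtain ⟨N, rfl⟩ := hLM
  exact (follows_append.mp h).1

theorem mem_piece_letterInv {δ : CIET A} {l : A × Bool} {x : ℝ} (h : x ∈ δ.piece l) :
    x + δ.transl (FreeGroup.mk [l]) ∈ δ.piece (letterInv l) := by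
  rw [transl_letter]
  have h1 : (letterInv l).1 = l.1 := rfl
  constructor
  · linarith [h.1]
  · rw [h1]; linarith [h.2]

theorem Follows.invRev {δ : CIET A} {L : List (A × Bool)} {x : ℝ} (h : δ.Follows L x) :
    δ.Follows (FreeGroup.invRev L) (x + δ.transl (FreeGroup.mk L)) := by
  induction L generalizing x with
  | nil => exact trivial
  | cons l L ih =>
    have h1 := ih h.2
    have h2 : FreeGroup.invRev [l] = [letterInv l] := rfl
    rw [FreeGroup.invRev_cons, follows_append, h2, follows_singleton, mk_cons l L, transl_mul,
      ← FreeGroup.inv_mk, transl_inv, ← add_assoc]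
    refine ⟨h1, ?_⟩
    rw [add_neg_cancel_right]
    exact mem_piece_letterInv h.1

/-- The domain of a composition of translations between intervals is an interval. -/
theorem Follows.convex {δ : CIET A} {L : List (A × Bool)} {x y z : ℝ} (hx : δ.Follows L x)
    (hz : δ.Follows L z) (hxy : x ≤ y) (hyz : y ≤ z) : δ.Follows L y := by
  induction L generalizing x y z with
  | nil => trivial
  | cons l L ih =>
    exact ⟨⟨hx.1.1.trans hxy, hyz.trans hz.1.2⟩,
      ih hx.2 hz.2 (by linarith) (by linarith)⟩

theorem isClosed_follows (δ : CIET A) (L : List (A × Bool)) : IsClosed {x | δ.Follows L x} := by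
  induction L with
  | nil => simp [Follows]
  | cons l L ih =>
    exact IsClosed.inter isClosed_Icc (ih.preimage (by fun_prop : Continuous fun x : ℝ =>
      x + δ.transl (FreeGroup.mk [l])))

theorem eq_of_mem_piece {δ : CIET A} {l c : A × Bool} (hlc : l.2 = c.2) {x y : ℝ} (hxy : x < y)
    (hxl : x ∈ δ.piece l) (hyl : y ∈ δ.piece l) (hxc : x ∈ δ.piece c) (hyc : y ∈ δ.piece c) :
    l = c := by
  refine Prod.ext ?_ hlc
  by_contra hne
  obtain ⟨a, e⟩ := l
  obtain ⟨b, e'⟩ := c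
  obtain rfl : e = e' := hlc
  have hne' : (bif e then δ.pos0 else δ.pos1) a ≠ (bif e then δ.pos0 else δ.pos1) b :=
    fun h => hne (Equiv.injective _ h)
  rcases lt_or_gt_of_ne hne' with h | h
  · have h1 : δ.edge (a, e) + δ.len a ≤ δ.edge (b, e) := leftSum_add_len_le δ.len_pos h
    linarith [hyl.2, hxc.1]
  · have h1 : δ.edge (b, e) + δ.len b ≤ δ.edge (a, e) := leftSum_add_len_le δ.len_pos h
    linarith [hyc.2, hxl.1]

/-- Closed pieces of the same sign meet at most in an endpoint, which is the left endpoint of the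
piece further to the right. -/
theorem eq_edge_of_mem_piece {δ : CIET A} {l c : A × Bool} (hlc : l.2 = c.2) (hne : l ≠ c) {x : ℝ}
    (hl : x ∈ δ.piece l) (hc : x ∈ δ.piece c) : x = δ.edge l ∨ x = δ.edge c := by
  obtain ⟨a, e⟩ := l
  obtain ⟨b, e'⟩ := c
  obtain rfl : e = e' := hlc
  have hne' : (bif e then δ.pos0 else δ.pos1) a ≠ (bif e then δ.pos0 else δ.pos1) b :=
    fun h => hne (by rw [Equiv.injective _ h])
  rcases lt_or_gt_of_ne hne' with h | h
  · have h1 : δ.edge (a, e) + δ.len a ≤ δ.edge (b, e) := leftSum_add_len_le δ.len_pos h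
    right
    linarith [hl.2, hc.1]
  · have h1 : δ.edge (b, e) + δ.len b ≤ δ.edge (a, e) := leftSum_add_len_le δ.len_pos h
    left
    linarith [hc.2, hl.1]

end Follows

/-! ### Rauzy induction -/

section Rauzy

variable {A : Type*} [Fintype A] [DecidableEq A]

/-- The automorphism `φ` describes the first returns of `δ` to the interval of `δ'`: itineraries
under `δ'` are mapped to itineraries under `δ`, and the left endpoints of the pieces of `δ` are
in the orbits of those of the pieces of `δ'`. -/
structure Induces (δ' δ : CIET A) (φ : MulAut (FreeGroup A)) : Prop where
  preservesSign : PreservesSign φ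
  follows : ∀ e g x, IsSigned e g → δ'.Follows g.toWord x → δ.Follows (φ g).toWord x
  transl_eq : ∀ g, δ'.transl g = δ.transl (φ g)
  edge_eq : ∀ l, ∃ p, IsSigned l.2 p ∧ (∀ᶠ z in nhds (δ'.edge l), δ.Follows p.toWord z) ∧
    δ.edge l = δ'.edge l + δ.transl p
  sum_lt : ∑ a, δ'.len a < ∑ a, δ.len a

theorem Induces.comp {δ'' δ' δ : CIET A} {φ ψ : MulAut (FreeGroup A)} (hψ : Induces δ'' δ' ψ)
    (hφ : Induces δ' δ φ) : Induces δ'' δ (φ * ψ) where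
  preservesSign := hφ.preservesSign.mul hψ.preservesSign
  follows e g x hg hx := hφ.follows e _ x (hψ.preservesSign e g hg).1 (hψ.follows e g x hg hx)
  transl_eq g := (hψ.transl_eq g).trans (hφ.transl_eq _)
  edge_eq l := by
    obtain ⟨p, hp, hp1, hp2⟩ := hψ.edge_eq l
    obtain ⟨q, hq, hq1, hq2⟩ := hφ.edge_eq l
    have hs := (hφ.preservesSign _ _ hp).1
    have ht := hφ.transl_eq p
    -- The word `p` leads from the endpoint in `δ''` to that in `δ'` and is read in `δ` as `φ p`;
    -- then `q` leads on to the endpoint in `δ`.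
    refine ⟨φ p * q, hs.mul hq, ?_, ?_⟩
    · have hc : Filter.Tendsto (fun z => z + δ.transl (φ p)) (nhds (δ''.edge l))
          (nhds (δ'.edge l)) := by
        have : Continuous fun z : ℝ => z + δ.transl (φ p) := by fun_prop
        convert this.tendsto (δ''.edge l) using 2
        rw [hp2, ht]
      filter_upwards [hp1, hc.eventually hq1] with z h1 h2
      rw [hs.toWord_mul hq, follows_append, FreeGroup.mk_toWord]
      exact ⟨hφ.follows _ p z hp h1, h2⟩
    · rw [hq2, hp2, transl_mul, ht, add_assoc]
  sum_lt := hψ.sum_lt.trans hφ.sum_lt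

/-- `δ'` is obtained from `δ` by removing the piece of the letter `(b, e)` from the right end of
the piece of the letter `(w, !e)`, and `σ` is the corresponding Dehn twist. -/
structure RauzyStep (δ' δ : CIET A) (σ : MulAut (FreeGroup A)) (e : Bool) (w b : A) : Prop where
  ne : w ≠ b
  len_lt : δ.len b < δ.len w
  right_eq : δ.edge (w, !e) + δ.len w = δ.edge (b, e) + δ.len b
  len_winner : δ'.len w = δ.len w - δ.len b
  len_eq : ∀ c, c ≠ w → δ'.len c = δ.len c
  edge_not : ∀ c, δ'.edge (c, !e) = δ.edge (c, !e)
  edge_eq : ∀ c, c ≠ b → δ'.edge (c, e) = δ.edge (c, e)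
  edge_loser : δ'.edge (b, e) = δ.edge (w, e) + δ.len w - δ.len b
  map_loser : σ (FreeGroup.mk [(b, e)]) = FreeGroup.mk [(w, e), (b, e)]
  map_eq : ∀ c, c ≠ b → σ (FreeGroup.mk [(c, e)]) = FreeGroup.mk [(c, e)]

namespace RauzyStep

variable {δ' δ : CIET A} {σ : MulAut (FreeGroup A)} {e : Bool} {w b : A}

theorem transl_eq (h : RauzyStep δ' δ σ e w b) (g : FreeGroup A) :
    δ'.transl g = δ.transl (σ g) := by
  have key : ∀ c, δ'.transl (FreeGroup.mk [(c, e)]) = δ.transl (σ (FreeGroup.mk [(c, e)])) := by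
    intro c
    by_cases hc : c = b
    · subst hc
      rw [h.map_loser, mk_cons (w, e), transl_mul, transl_letter, transl_letter, transl_letter]
      have h1 := h.right_eq
      have h2 := h.edge_not c
      have h3 := h.edge_loser
      simp only [letterInv]
      linarith
    · rw [h.map_eq c hc, transl_letter, transl_letter, h.edge_eq c hc]
      simp only [letterInv]
      rw [h.edge_not]
  have hom : δ'.translHom = δ.translHom.comp σ.toMonoidHom := by
    ext c
    have hc := key c
    cases e
    · have h1 : FreeGroup.mk [(c, false)] = (FreeGroup.of c)⁻¹ := by
        simp [FreeGroup.of, FreeGroup.inv_mk, FreeGroup.invRev]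
      rw [h1, map_inv, transl_inv, transl_inv, neg_inj] at hc
      exact hc
    · exact hc
  exact congrArg Multiplicative.toAdd (DFunLike.congr_fun hom g)

theorem toWord_map_letter (h : RauzyStep δ' δ σ e w b) (c : A) :
    IsSigned e (σ (FreeGroup.mk [(c, e)])) ∧
      (σ (FreeGroup.mk [(c, e)])).toWord = if c = b then [(w, e), (b, e)] else [(c, e)] := by
  split_ifs with hc
  · subst hc
    rw [h.map_loser]
    exact ⟨isSigned_mk (by simp), toWord_mk_of_signed (e := e) (by simp)⟩
  · rw [h.map_eq c hc]
    exact ⟨isSigned_mk (by simp), toWord_mk_of_signed (e := e) (by simp)⟩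

omit [Fintype A] [DecidableEq A] in
theorem letter_eq {e : Bool} (l : A × Bool) : l = (l.1, e) ∨ l = letterInv (l.1, e) := by
  rcases l with ⟨a, e'⟩
  cases e <;> cases e' <;> simp [letterInv]

theorem preservesSign (h : RauzyStep δ' δ σ e w b) : PreservesSign σ := by
  apply PreservesSign.of_letters
  intro l
  obtain ⟨h1, h2⟩ := h.toWord_map_letter l.1
  have h3 : 1 ≤ (σ (FreeGroup.mk [(l.1, e)])).toWord.length := by
    rw [h2]
    split_ifs <;> simp
  rcases letter_eq (e := e) l with hl | hl
  · rw [hl]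
    exact ⟨h1, h3⟩
  · rw [hl, mk_letterInv, map_inv, FreeGroup.toWord_inv, FreeGroup.invRev_length]
    exact ⟨h1.inv, h3⟩

/-- The new piece of the loser is the right end of the piece `(w, e)`. The winner carries it to the
right end of the piece `(w, !e)`, which is where the old piece of the loser lies; hence the image `w
b`. -/
theorem follows_letter (h : RauzyStep δ' δ σ e w b) {l : A × Bool} {x : ℝ}
    (hx : x ∈ δ'.piece l) : δ.Follows (σ (FreeGroup.mk [l])).toWord x := by
  have hlt := h.len_lt
  have key : ∀ c x, x ∈ δ'.piece (c, e) → δ.Follows (σ (FreeGroup.mk [(c, e)])).toWord x := by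
    intro c x hx
    rw [(h.toWord_map_letter c).2]
    obtain ⟨hx1, hx2⟩ := hx
    have hwpos := δ.len_pos w
    have hbpos := δ.len_pos b
    split_ifs with hc
    · subst hc
      rw [h.edge_loser] at hx1 hx2
      rw [h.len_eq c h.ne.symm] at hx2
      rw [follows_cons, follows_singleton, transl_letter]
      have h1 := h.right_eq
      simp only [letterInv, piece, Set.mem_Icc]
      refine ⟨⟨?_, ?_⟩, ?_, ?_⟩ <;> linarith
    · rw [h.edge_eq c hc] at hx1 hx2
      rw [follows_singleton]
      refine ⟨hx1, hx2.trans ?_⟩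
      by_cases hcw : c = w
      · subst hcw
        simp only [h.len_winner]
        linarith
      · simp only [h.len_eq c hcw, le_refl]
  rcases letter_eq (e := e) l with hl | hl
  · rw [hl] at hx ⊢
    exact key _ _ hx
  · have h1 := mem_piece_letterInv hx
    rw [hl, letterInv_letterInv] at h1
    have h2 := (key _ _ h1).invRev
    rw [FreeGroup.mk_toWord, ← h.transl_eq, mk_letterInv, transl_inv, neg_add_cancel_right,
      ← FreeGroup.toWord_inv, ← map_inv, ← mk_letterInv, ← hl] at h2
    exact h2

theorem follows (h : RauzyStep δ' δ σ e w b) {e' : Bool} {g : FreeGroup A} {x : ℝ}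
    (hg : IsSigned e' g) (hx : δ'.Follows g.toWord x) : δ.Follows (σ g).toWord x := by
  have hg' := FreeGroup.mk_toWord (x := g)
  unfold IsSigned at hg
  revert hg hx hg'
  generalize g.toWord = L
  rintro hg hx rfl
  induction L generalizing x with
  | nil => simp [← FreeGroup.one_eq_mk, follows_nil]
  | cons l L ih =>
    have h1 : IsSigned e' (σ (FreeGroup.mk [l])) := by
      have := (h.preservesSign _ _ (isSigned_letter l)).1
      rwa [hg l (by simp)] at this
    have h2 : IsSigned e' (σ (FreeGroup.mk L)) :=
      (h.preservesSign _ _ (isSigned_mk fun c hc => hg c (by simp [hc]))).1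
    rw [mk_cons, map_mul, h1.toWord_mul h2, follows_append, FreeGroup.mk_toWord, ← h.transl_eq]
    exact ⟨h.follows_letter hx.1, ih (fun c hc => hg c (by simp [hc])) hx.2⟩

theorem induces (h : RauzyStep δ' δ σ e w b) : Induces δ' δ σ where
  preservesSign := h.preservesSign
  follows _ _ _ hg hx := h.follows hg hx
  transl_eq := h.transl_eq
  edge_eq l := by
    by_cases hl : l = (b, e)
    · subst hl
      have h1 := h.right_eq
      have h2 := h.edge_loser
      have hlt := h.len_lt
      have hbpos := δ.len_pos b
      -- Only the left endpoint of the loser has moved. The new one is interior to the piece of the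
      -- winner, because `0 < δ.len b < δ.len w`, and the winner takes it to the old one.
      refine ⟨FreeGroup.mk [(w, e)], isSigned_letter (w, e), ?_, ?_⟩
      · have h3 : δ.piece (w, e) ∈ nhds (δ'.edge (b, e)) :=
          Icc_mem_nhds (by linarith) (by simp only; linarith)
        filter_upwards [h3] with z hz
        rw [toWord_mk_of_signed (e := e) (by simp), follows_singleton]
        exact hz
      · rw [transl_letter, h2]
        simp only [letterInv]
        linarith
    · refine ⟨1, isSigned_one _, by simp [follows_nil], ?_⟩
      rw [transl_one, add_zero]
      obtain ⟨c, e'⟩ := l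
      by_cases he : e' = e
      · subst he
        exact (h.edge_eq c fun hc => hl (by rw [hc])).symm
      · obtain rfl : e' = !e := by cases e <;> cases e' <;> simp_all
        exact (h.edge_not c).symm
  sum_lt := by
    apply Finset.sum_lt_sum
    · intro c _
      by_cases hc : c = w
      · subst hc
        rw [h.len_winner]
        linarith [δ.len_pos b]
      · exact (h.len_eq c hc).le
    · exact ⟨w, Finset.mem_univ w, by rw [h.len_winner]; linarith [δ.len_pos b]⟩

end RauzyStep

variable [Nontrivial A]

omit [DecidableEq A] in
theorem last0_ne_last1 {δ : CIET A} (h : δ.HasRauzy) : δ.last0 ≠ δ.last1 :=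
  fun e => h (congrArg δ.len e)

/-- The two types become one by exchanging the roles of the two partitions: in type `0` the twist is
read on inverse letters, where `α₁⁻¹ ↦ α₀⁻¹ α₁⁻¹` has the same shape as `α₀ ↦ α₁ α₀` in type `1`. -/
theorem exists_rauzyStep {δ : CIET A} (h : δ.HasRauzy) :
    ∃ e w b, RauzyStep δ.rauzy δ δ.dehnTwist e w b := by
  have hne := last0_ne_last1 h
  have hr0 : δ.edge (δ.last0, true) + δ.len δ.last0 = ∑ c, δ.len c :=
    leftSum_add_len_last δ.pos0 δ.len
  have hr1 : δ.edge (δ.last1, false) + δ.len δ.last1 = ∑ c, δ.len c :=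
    leftSum_add_len_last δ.pos1 δ.len
  rcases lt_or_gt_of_ne h with hlt | hlt
  · have hp0 : δ.rauzy.pos0 = moveLast δ.pos0 δ.last1 := by
      simp [rauzy, not_lt.mpr hlt.le, hlt]
    have hp1 : δ.rauzy.pos1 = δ.pos1 := by
      simp [rauzy, not_lt.mpr hlt.le, hlt]
    have hl : ∀ c, δ.rauzy.len c =
        if c = δ.last1 then δ.len δ.last1 - δ.len δ.last0 else δ.len c := by
      intro c
      simp [rauzy, not_lt.mpr hlt.le, hlt]
    have hσ : δ.dehnTwist = leftTwist δ.last0 δ.last1 hne.symm := by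
      simp [dehnTwist, not_lt.mpr hlt.le, hlt]
    have hw : δ.rauzy.len δ.last1 = δ.len δ.last1 - δ.len δ.last0 := by rw [hl, if_pos rfl]
    have hle : ∀ c, c ≠ δ.last1 → δ.rauzy.len c = δ.len c := fun c hc => by rw [hl, if_neg hc]
    have hmove := leftSum_moveLast (π := δ.pos0) (b := δ.last0) rfl hne.symm hw hle
    refine ⟨true, δ.last1, δ.last0, hne.symm, hlt, hr1.trans hr0.symm, hw, hle, ?_, ?_, ?_, ?_, ?_⟩
    · intro c
      change leftSum δ.rauzy.pos1 _ c = leftSum δ.pos1 _ c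
      rw [hp1]
      exact leftSum_congr_of_ne_last hle c
    · intro c hc
      change leftSum δ.rauzy.pos0 _ c = leftSum δ.pos0 _ c
      rw [hp0, hmove, if_neg hc]
    · change leftSum δ.rauzy.pos0 _ δ.last0 = leftSum δ.pos0 _ δ.last1 + _ - _
      rw [hp0, hmove, if_pos rfl]
    · rw [hσ]
      change sendGen _ _ (FreeGroup.of _) = _
      simp only [sendGen, FreeGroup.lift_apply_of, if_pos]
      rfl
    · intro c hc
      rw [hσ]
      change sendGen _ _ (FreeGroup.of _) = _
      simp only [sendGen, FreeGroup.lift_apply_of, if_neg hc]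
      rfl
  · have hp0 : δ.rauzy.pos0 = δ.pos0 := by
      simp [rauzy, hlt]
    have hp1 : δ.rauzy.pos1 = moveLast δ.pos1 δ.last0 := by
      simp [rauzy, hlt]
    have hl : ∀ c, δ.rauzy.len c =
        if c = δ.last0 then δ.len δ.last0 - δ.len δ.last1 else δ.len c := by
      intro c
      simp [rauzy, hlt]
    have hσ : δ.dehnTwist = rightTwist δ.last1 δ.last0 hne := by
      simp [dehnTwist, hlt]
    have hw : δ.rauzy.len δ.last0 = δ.len δ.last0 - δ.len δ.last1 := by rw [hl, if_pos rfl]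
    have hle : ∀ c, c ≠ δ.last0 → δ.rauzy.len c = δ.len c := fun c hc => by rw [hl, if_neg hc]
    have hmove := leftSum_moveLast (π := δ.pos1) (b := δ.last1) rfl hne hw hle
    have hinv : ∀ c : A, FreeGroup.mk [(c, false)] = (FreeGroup.of c)⁻¹ := fun c => by
      simp [FreeGroup.of, FreeGroup.inv_mk, FreeGroup.invRev]
    refine ⟨false, δ.last0, δ.last1, hne, hlt, hr0.trans hr1.symm, hw, hle, ?_, ?_, ?_, ?_, ?_⟩
    · intro c
      change leftSum δ.rauzy.pos0 _ c = leftSum δ.pos0 _ c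
      rw [hp0]
      exact leftSum_congr_of_ne_last hle c
    · intro c hc
      change leftSum δ.rauzy.pos1 _ c = leftSum δ.pos1 _ c
      rw [hp1, hmove, if_neg hc]
    · change leftSum δ.rauzy.pos1 _ δ.last1 = leftSum δ.pos1 _ δ.last0 + _ - _
      rw [hp1, hmove, if_pos rfl]
    · rw [hσ, hinv, map_inv, mk_cons, hinv, hinv, ← mul_inv_rev]
      congr 1
      change sendGen _ _ (FreeGroup.of _) = _
      simp only [sendGen, FreeGroup.lift_apply_of, if_pos]
    · intro c hc
      rw [hσ, hinv, map_inv]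
      congr 1
      change sendGen _ _ (FreeGroup.of _) = _
      simp only [sendGen, FreeGroup.lift_apply_of, if_neg hc]

theorem induces_iterate {δ : CIET A} {n : ℕ} (hn : 1 ≤ n)
    (h : ∀ i < n, HasRauzy (rauzy^[i] δ)) : Induces (rauzy^[n] δ) δ
      ((List.range n).map fun i => dehnTwist (rauzy^[i] δ)).prod := by
  have step : ∀ i, HasRauzy (rauzy^[i] δ) →
      Induces (rauzy^[i + 1] δ) (rauzy^[i] δ) (dehnTwist (rauzy^[i] δ)) := fun i hi => by
    obtain ⟨e, w, b, hs⟩ := exists_rauzyStep hi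
    rw [Function.iterate_succ_apply']
    exact hs.induces
  induction n, hn using Nat.le_induction with
  | base => simpa using step 0 (h 0 one_pos)
  | succ n _ ih =>
    rw [List.range_succ, List.map_append, List.prod_append, List.map_singleton,
      List.prod_singleton]
    exact (step n (h n n.lt_succ_self)).comp (ih fun i hi => h i (hi.trans n.lt_succ_self))

/-- The automorphism `φ` describes the first returns of `δ` to its subinterval of ratio `η`. -/
structure SelfInduces (δ : CIET A) (φ : MulAut (FreeGroup A)) (η : ℝ) : Prop where
  ratio_pos : 0 < η
  ratio_lt_one : η < 1
  preservesSign : PreservesSign φ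
  follows : ∀ e g x, IsSigned e g → δ.Follows g.toWord x → δ.Follows (φ g).toWord (η * x)
  transl_map : ∀ g, δ.transl (φ g) = η * δ.transl g
  edge_eq : ∀ l, ∃ p, IsSigned l.2 p ∧ (∀ᶠ z in nhds (η * δ.edge l), δ.Follows p.toWord z) ∧
    δ.edge l = η * δ.edge l + δ.transl p

/-- The induced system is `δ` scaled by `η`, so its endpoints, translation lengths and itineraries
are those of `δ` after multiplication by `η`. -/
theorem exists_selfInduces (δ : CIET A) (h : δ.IsSelfInduced) :
    ∃ η, SelfInduces δ (δ.deltaAutomorphism h) η := by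
  classical
  obtain ⟨hn, hR, h0, h1, η, hη, hlen⟩ := Nat.find_spec h
  have hind := induces_iterate hn hR
  set n := Nat.find h
  set δ' := rauzy^[n] δ
  have hedge : ∀ l, δ'.edge l = η * δ.edge l := by
    intro l
    unfold edge leftSum
    rw [h0, h1, Finset.mul_sum]
    exact Finset.sum_congr rfl fun c _ => hlen c
  have hletter : ∀ l, δ'.transl (FreeGroup.mk [l]) = η * δ.transl (FreeGroup.mk [l]) := by
    intro l
    rw [transl_letter, transl_letter, hedge, hedge, mul_sub]
  have htransl : ∀ g, δ'.transl g = η * δ.transl g := by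
    intro g
    rw [← FreeGroup.mk_toWord (x := g)]
    induction g.toWord with
    | nil => simp [← FreeGroup.one_eq_mk, transl_one]
    | cons l L ih => rw [mk_cons, transl_mul, transl_mul, hletter, ih, mul_add]
  have hfollows : ∀ L x, δ.Follows L x → δ'.Follows L (η * x) := by
    intro L
    induction L with
    | nil => exact fun _ _ => trivial
    | cons l L ih =>
      intro x hx
      refine ⟨⟨?_, ?_⟩, ?_⟩
      · rw [hedge]
        exact mul_le_mul_of_nonneg_left hx.1.1 hη.le
      · rw [hedge, hlen, ← mul_add]
        exact mul_le_mul_of_nonneg_left hx.1.2 hη.le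
      · rw [hletter, ← mul_add]
        exact ih _ hx.2
  refine ⟨η, hη, ?_, hind.preservesSign, ?_, ?_, ?_⟩
  -- Each induction shortens the total length, which is here multiplied by `η`.
  · have hlt := hind.sum_lt
    simp only [hlen, ← Finset.mul_sum] at hlt
    have hpos : 0 < ∑ a, δ.len a := Finset.sum_pos (fun a _ => δ.len_pos a) Finset.univ_nonempty
    by_contra hge
    nlinarith [not_lt.mp hge]
  · exact fun e g x hg hx => hind.follows e g _ hg (hfollows _ x hx)
  · exact fun g => (hind.transl_eq g).symm.trans (htransl g)
  · intro l
    have := hind.edge_eq l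
    rwa [hedge] at this

end Rauzy

end CIET

/-! ### Lines in the Cayley tree coded by a point of the interval -/

/-- The two ends of a point of the double boundary. -/
def DoubleBoundary.ends {A : Type*} (Z : DoubleBoundary A) (e : Bool) : FreeBoundary A :=
  bif e then Z.snd else Z.fst

namespace DoubleBoundary

variable {A : Type*} [DecidableEq A]

theorem ends_letterMul (l : A × Bool) (Z : DoubleBoundary A) :
    (Z.letterMul l).ends = fun e => (Z.ends e).letterMul l := by
  funext e
  cases e <;> rfl

omit [DecidableEq A] in
theorem isOpen_letter_eq (e : Bool) (i : ℕ) (c : A × Bool) :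
    IsOpen {Z : DoubleBoundary A | (Z.ends e).letter i = c} := by
  have h1 : IsOpen {V : FreeBoundary A | V.letter i = c} := by
    let _ : TopologicalSpace (A × Bool) := ⊥
    have : DiscreteTopology (A × Bool) := ⟨rfl⟩
    have h : Continuous fun V : FreeBoundary A => V.letter i :=
      (continuous_apply i).comp continuous_induced_dom
    exact (isOpen_discrete {c}).preimage h
  have h2 : Continuous fun Z : DoubleBoundary A => (Z.fst, Z.snd) := continuous_induced_dom
  cases e
  · exact h1.preimage (continuous_fst.comp h2)
  · exact h1.preimage (continuous_snd.comp h2)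

end DoubleBoundary

/-- The negative end has only negative letters, and the positive end only positive ones. -/
def Oriented {A : Type*} (R : Bool → FreeBoundary A) : Prop := ∀ e, (R e).Signed e

namespace CIET

variable {A : Type*} [Fintype A] [DecidableEq A]

/-- The first `n` letters of both ends of `R` are itineraries of `x`. -/
def Window (δ : CIET A) (R : Bool → FreeBoundary A) (n : ℕ) (x : ℝ) : Prop :=
  ∀ e, δ.Follows ((R e).pre n) x

/-- Each window of the oriented line `R` is the itinerary of a non-degenerate interval. -/
def Admissible (δ : CIET A) (R : Bool → FreeBoundary A) : Prop :=
  Oriented R ∧ ∀ n, ∃ x y, x < y ∧ δ.Window R n x ∧ δ.Window R n y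

/-- The line `R` is coded by `x`, as a limit of codings of points `x + s ε` with `ε > 0`. -/
def SideCoded (δ : CIET A) (s : ℝ) (R : Bool → FreeBoundary A) (x : ℝ) : Prop :=
  ∀ n, δ.Window R n x ∧ ∀ᶠ ε in nhdsWithin 0 (Set.Ioi 0), δ.Window R n (x + s * ε)

omit [DecidableEq A] in
theorem Window.mono {δ : CIET A} {R : Bool → FreeBoundary A} {m n : ℕ} {x : ℝ} (hmn : m ≤ n)
    (h : δ.Window R n x) : δ.Window R m x :=
  fun e => (h e).of_prefix ((R e).pre_prefix hmn)

omit [DecidableEq A] in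
theorem Window.convex {δ : CIET A} {R : Bool → FreeBoundary A} {n : ℕ} {x y z : ℝ}
    (hx : δ.Window R n x) (hz : δ.Window R n z) (hxy : x ≤ y) (hyz : y ≤ z) : δ.Window R n y :=
  fun e => (hx e).convex (hz e) hxy hyz

omit [DecidableEq A] in
theorem isClosed_window (δ : CIET A) (R : Bool → FreeBoundary A) (n : ℕ) :
    IsClosed {x | δ.Window R n x} := by
  simp only [Window, Set.ofPred_forall]
  exact isClosed_iInter fun e => δ.isClosed_follows _

omit [DecidableEq A] in
theorem Window.mem_piece {δ : CIET A} {R : Bool → FreeBoundary A} {n : ℕ} {x : ℝ}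
    (h : δ.Window R (n + 1) x) (e : Bool) : x ∈ δ.piece ((R e).letter 0) := by
  have h1 : δ.Follows ((R e).pre 1) x := (Window.mono (by omega) h) e
  exact follows_singleton.mp h1

/-! ### Moving the base point along a line -/

omit [Fintype A] in
theorem oriented_letterMul {R : Bool → FreeBoundary A} (hR : Oriented R) {e : Bool}
    {l : A × Bool} (hl : (R e).letter 0 = l) :
    Oriented (fun e' => (R e').letterMul (letterInv l)) := by
  have hle : l.2 = e := by rw [← hl]; exact hR e 0
  intro e' i
  by_cases he : (R e').letter 0 = letterInv (letterInv l)
  · rw [FreeBoundary.letterMul_of_eq he]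
    exact hR e' _
  · cases i with
    | zero =>
      rw [FreeBoundary.letterMul_zero_of_ne he, letterInv_snd, hle]
      have : e' ≠ e := by
        rintro rfl
        exact he (by rw [hl, letterInv_letterInv])
      cases e <;> cases e' <;> simp_all
    | succ i =>
      rw [FreeBoundary.letterMul_succ_of_ne he]
      exact hR e' _

/-- The letter `l` leaves one end and its inverse is put in front of the other, while the point
moves by the isometry of `l`. The shortened end costs one letter of the window. -/
theorem Window.letterMul {δ : CIET A} {R : Bool → FreeBoundary A} {e : Bool}
    {l : A × Bool} (hl : (R e).letter 0 = l) {n : ℕ} {x : ℝ} (h : δ.Window R (n + 1) x) :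
    δ.Window (fun e' => (R e').letterMul (letterInv l)) n (x + δ.transl (FreeGroup.mk [l])) := by
  intro e'
  by_cases he : (R e').letter 0 = letterInv (letterInv l)
  · have h1 := h e'
    rw [FreeBoundary.letterMul_pre_of_eq he, letterInv_letterInv] at h1
    exact h1.2
  · refine Follows.of_prefix ?_ (FreeBoundary.pre_prefix _ n.le_succ)
    rw [FreeBoundary.letterMul_pre_of_ne he]
    refine ⟨mem_piece_letterInv (hl ▸ h.mem_piece e), ?_⟩
    rw [mk_letterInv, transl_inv, add_neg_cancel_right]
    exact h.mono n.le_succ e'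

theorem Admissible.letterMul {δ : CIET A} {R : Bool → FreeBoundary A} (hR : δ.Admissible R)
    {e : Bool} {l : A × Bool} (hl : (R e).letter 0 = l) :
    δ.Admissible (fun e' => (R e').letterMul (letterInv l)) := by
  refine ⟨oriented_letterMul hR.1 hl, fun n => ?_⟩
  obtain ⟨x, y, hxy, hx, hy⟩ := hR.2 (n + 1)
  exact ⟨_, _, add_lt_add_left hxy _, hx.letterMul hl, hy.letterMul hl⟩

/-- If an element of the free group maps an oriented line to an oriented line, it translates
its codings. -/
theorem exists_window_act (δ : CIET A) {L : List (A × Bool)} (hL : FreeGroup.IsReduced L)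
    {R : Bool → FreeBoundary A} (hR : Oriented R)
    (hLR : Oriented fun e => FreeBoundary.act (FreeGroup.mk L) (R e)) (n : ℕ) :
    ∃ m, ∀ x, δ.Window R m x →
      δ.Window (fun e => FreeBoundary.act (FreeGroup.mk L) (R e)) n
        (x - δ.transl (FreeGroup.mk L)) := by
  induction L using List.reverseRecOn generalizing R with
  | nil => exact ⟨n, fun x hx => by simpa [← FreeGroup.one_eq_mk, transl_one] using hx⟩
  | append_singleton L l ih =>
    by_cases h : ∃ e, (R e).letter 0 = letterInv l
    · obtain ⟨e, he⟩ := h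
      have hact : ∀ V : FreeBoundary A, FreeBoundary.act (FreeGroup.mk (L ++ [l])) V =
          FreeBoundary.act (FreeGroup.mk L) (V.letterMul l) := by
        intro V
        rw [← FreeGroup.mul_mk, map_mul, Equiv.Perm.mul_apply, FreeBoundary.act_letter]
      have h1 := oriented_letterMul hR he
      rw [letterInv_letterInv] at h1
      simp only [hact] at hLR ⊢
      obtain ⟨m, hm⟩ := ih (hL.infix ⟨[], [l], by simp⟩) h1 hLR
      refine ⟨m + 1, fun x hx => ?_⟩
      have h2 := hx.letterMul he
      rw [letterInv_letterInv, mk_letterInv, transl_inv] at h2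
      have h3 := hm _ h2
      rw [← FreeGroup.mul_mk, transl_mul]
      convert h3 using 1
      ring
    -- Otherwise nothing cancels, and both ends of the image begin with the same letter, although
    -- they have opposite signs.
    · push Not at h
      exfalso
      obtain ⟨c, M, hM⟩ : ∃ c M, L ++ [l] = c :: M := by
        cases L with
        | nil => exact ⟨l, [], rfl⟩
        | cons c M => exact ⟨c, M ++ [l], rfl⟩
      have hlast : (c :: M).getLast? = some l := by rw [← hM]; simp
      rw [hM] at hL hLR
      have h1 := FreeBoundary.act_letter_zero hL hlast (h true)
      have h2 := FreeBoundary.act_letter_zero hL hlast (h false)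
      have h3 := hLR true 0
      have h4 := hLR false 0
      simp only [h1, h2] at h3 h4
      simp [h3] at h4

omit [DecidableEq A] in
-- A single point may have several itineraries because pieces share endpoints; two distinct points
-- cannot lie together in two different pieces of the same sign.
theorem eq_of_follows {δ : CIET A} {e : Bool} {L M : List (A × Bool)} (hL : ∀ l ∈ L, l.2 = e)
    (hM : ∀ l ∈ M, l.2 = e) (hlen : L.length = M.length) {x y : ℝ} (hxy : x < y)
    (hLx : δ.Follows L x) (hLy : δ.Follows L y) (hMx : δ.Follows M x) (hMy : δ.Follows M y) :
    L = M := by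
  induction L generalizing M x y with
  | nil => exact (List.length_eq_zero_iff.mp hlen.symm).symm
  | cons l L ih =>
    cases M with
    | nil => simp at hlen
    | cons c M =>
      obtain rfl : l = c :=
        eq_of_mem_piece ((hL l (by simp)).trans (hM c (by simp)).symm) hxy hLx.1 hLy.1 hMx.1 hMy.1
      rw [ih (fun d hd => hL d (by simp [hd])) (fun d hd => hM d (by simp [hd]))
        (by simpa using hlen) (add_lt_add_left hxy _) hLx.2 hLy.2 hMx.2 hMy.2]

/-! ### Uniqueness and transport of one-sided codings -/

namespace SideCoded

variable {δ : CIET A} {s : ℝ} {R R' : Bool → FreeBoundary A} {x : ℝ}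

omit [DecidableEq A] in
theorem ext_of_oriented (hs : s ≠ 0) (hR : Oriented R) (hR' : Oriented R')
    (h : δ.SideCoded s R x) (h' : δ.SideCoded s R' x) : R = R' := by
  funext e
  have hpre : ∀ n, (R e).pre n = (R' e).pre n := by
    intro n
    obtain ⟨ε, ⟨h1, h2⟩, hε⟩ :=
      (((h n).2.and (h' n).2).and (self_mem_nhdsWithin : Set.Ioi (0 : ℝ) ∈ _)).exists
    have hne : x ≠ x + s * ε := by
      intro he
      have : s * ε = 0 := by linarith
      rcases mul_eq_zero.mp this with h0 | h0
      · exact hs h0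
      · exact (ne_of_gt hε) h0
    have hlen : ((R e).pre n).length = ((R' e).pre n).length := by simp [FreeBoundary.pre_length]
    rcases lt_or_gt_of_ne hne with hlt | hlt
    · exact eq_of_follows (fun l hl => (hR e).mem_pre hl) (fun l hl => (hR' e).mem_pre hl) hlen hlt
        ((h n).1 e) (h1 e) ((h' n).1 e) (h2 e)
    · exact eq_of_follows (fun l hl => (hR e).mem_pre hl) (fun l hl => (hR' e).mem_pre hl) hlen hlt
        (h1 e) ((h n).1 e) (h2 e) ((h' n).1 e)
  ext1
  funext i
  have h1 := (R e).pre_getElem? (Nat.lt_succ_self i)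
  rw [hpre, (R' e).pre_getElem? (Nat.lt_succ_self i)] at h1
  exact (Option.some_injective _ h1).symm

/-- If all the points near `x` follow the word `L`, the base point of a line coded by `x`
can be moved along `L`. -/
theorem exists_act_eq (hs : s ≠ 0) {e : Bool} {L : List (A × Bool)} (hL : ∀ l ∈ L, l.2 = e)
    (hx : ∀ᶠ z in nhds x, δ.Follows L z) (hR : Oriented R) (h : δ.SideCoded s R x) :
    ∃ R', Oriented R' ∧ δ.SideCoded s R' (x + δ.transl (FreeGroup.mk L)) ∧
      ∀ e', R e' = FreeBoundary.act (FreeGroup.mk L) (R' e') := by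
  induction L generalizing R x with
  | nil =>
    refine ⟨R, hR, ?_, ?_⟩
    · simpa [← FreeGroup.one_eq_mk, transl_one] using h
    · simp [← FreeGroup.one_eq_mk]
  | cons l L ih =>
    have htend : Filter.Tendsto (fun ε => x + s * ε) (nhdsWithin 0 (Set.Ioi 0)) (nhds x) := by
      have : Continuous fun ε : ℝ => x + s * ε := by fun_prop
      have h0 := (this.tendsto 0).mono_left (nhdsWithin_le_nhds (s := Set.Ioi 0))
      simpa using h0
    have hl : (R e).letter 0 = l := by
      -- Both `x` and `x + s * ε` lie in the piece of `l` and in that of the first letter of `R e`,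
      -- so the two letters agree. A whole neighbourhood of `x` is used because the side `s` is
      -- arbitrary.
      obtain ⟨ε, ⟨h1, h2⟩, hε⟩ := (((h 1).2.and (htend.eventually hx)).and
        (self_mem_nhdsWithin : Set.Ioi (0 : ℝ) ∈ _)).exists
      have hne : x ≠ x + s * ε := by
        intro he
        have : s * ε = 0 := by linarith
        rcases mul_eq_zero.mp this with h0 | h0
        · exact hs h0
        · exact (ne_of_gt hε) h0
      have hsign : ((R e).letter 0).2 = l.2 := (hR e 0).trans (hL l (by simp)).symm
      have h3 := hx.self_of_nhds
      rcases lt_or_gt_of_ne hne with hlt | hlt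
      · exact eq_of_mem_piece hsign hlt ((h 1).1.mem_piece e) (h1.mem_piece e) h3.1 h2.1
      · exact eq_of_mem_piece hsign hlt (h1.mem_piece e) ((h 1).1.mem_piece e) h2.1 h3.1
    have hsh : δ.SideCoded s (fun e' => (R e').letterMul (letterInv l))
        (x + δ.transl (FreeGroup.mk [l])) := by
      intro n
      refine ⟨(h (n + 1)).1.letterMul hl, ?_⟩
      filter_upwards [(h (n + 1)).2] with ε hε
      have := hε.letterMul hl
      rwa [add_right_comm] at this
    have htr : Filter.Tendsto (fun z => z - δ.transl (FreeGroup.mk [l]))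
        (nhds (x + δ.transl (FreeGroup.mk [l]))) (nhds x) := by
      have : Continuous fun z : ℝ => z - δ.transl (FreeGroup.mk [l]) := by fun_prop
      simpa using this.tendsto (x + δ.transl (FreeGroup.mk [l]))
    have hx' : ∀ᶠ z in nhds (x + δ.transl (FreeGroup.mk [l])), δ.Follows L z := by
      filter_upwards [htr.eventually hx] with z hz
      simpa using hz.2
    obtain ⟨R', hR', hc, hact⟩ :=
      ih (fun c hc => hL c (by simp [hc])) hx' (oriented_letterMul hR hl) hsh
    refine ⟨R', hR', ?_, fun e' => ?_⟩
    · rw [mk_cons, transl_mul, ← add_assoc]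
      exact hc
    · rw [FreeBoundary.act_cons, ← hact]
      have := FreeBoundary.letterMul_letterInv (letterInv l) (R e')
      rw [letterInv_letterInv] at this
      exact this.symm

end SideCoded

/-! ### The attracting subshift -/

theorem Admissible.shiftPow {δ : CIET A} {Z : DoubleBoundary A} (hZ : δ.Admissible Z.ends) (n : ℤ) :
    δ.Admissible (Z.shiftPow n).ends := by
  have h1 : ∀ Z : DoubleBoundary A, δ.Admissible Z.ends → δ.Admissible Z.shift.ends := by
    intro Z hZ
    unfold DoubleBoundary.shift
    rw [DoubleBoundary.ends_letterMul]
    exact hZ.letterMul (e := true) rfl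
  have h2 : ∀ Z : DoubleBoundary A, δ.Admissible Z.ends → δ.Admissible Z.shiftInv.ends := by
    intro Z hZ
    unfold DoubleBoundary.shiftInv
    rw [DoubleBoundary.ends_letterMul]
    exact hZ.letterMul (e := false) rfl
  cases n with
  | ofNat n =>
    exact Function.Iterate.rec (motive := fun W : DoubleBoundary A => δ.Admissible W.ends) hZ h1 n
  | negSucc n =>
    exact Function.Iterate.rec (motive := fun W : DoubleBoundary A => δ.Admissible W.ends) hZ h2
      (n + 1)

namespace SelfInduces

variable {δ : CIET A} {φ : MulAut (FreeGroup A)} {η : ℝ}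

theorem follows_pow (h : SelfInduces δ φ η) {e : Bool} {g : FreeGroup A} (hg : IsSigned e g)
    {x : ℝ} (hx : δ.Follows g.toWord x) (k : ℕ) :
    δ.Follows ((φ ^ k) g).toWord (η ^ k * x) := by
  induction k with
  | zero => simpa using hx
  | succ k ih =>
    rw [pow_succ', pow_succ', mul_assoc]
    exact h.follows e _ _ ((h.preservesSign.pow k) e g hg).1 ih

/-- The identity `Xₙ⁻¹ Yₙ = φ^((n+1)k)(a)` holds without cancellation. The piece of `a`, scaled by
`η^((n+1)k)`, follows this word; after moving along `Xₙ⁻¹` it becomes a nondegenerate interval that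
follows both `Xₙ` and `Yₙ`. -/
theorem admissible_of_isAttractingPoint (h : SelfInduces δ φ η) {Z : DoubleBoundary A}
    (hZ : IsAttractingPoint φ Z) : δ.Admissible Z.ends := by
  obtain ⟨a, k, p, s, -, -, -, hp, hs, heq, hX, hY⟩ := hZ
  have hp : IsSigned true p := hp
  have hs : IsSigned true s := hs
  have ha : IsSigned true (FreeGroup.of a) := isSigned_letter (a, true)
  have hpow : ∀ m e g, IsSigned e g → IsSigned e ((φ ^ m) g) := fun m e g hg =>
    (h.preservesSign.pow m e g hg).1
  set X : ℕ → FreeGroup A := fun n => ((List.range (n + 1)).map fun i => (φ ^ (i * k)) p⁻¹).prod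
  set Y : ℕ → FreeGroup A := fun n =>
    FreeGroup.of a * ((List.range (n + 1)).map fun i => (φ ^ (i * k)) s).prod
  have hXs : ∀ n, IsSigned false (X n) := fun n => IsSigned.list_prod fun g hg => by
    obtain ⟨i, _, rfl⟩ := List.mem_map.mp hg
    exact hpow _ _ _ hp.inv
  have hYs : ∀ n, IsSigned true (Y n) := fun n => ha.mul <| IsSigned.list_prod fun g hg => by
    obtain ⟨i, _, rfl⟩ := List.mem_map.mp hg
    exact hpow _ _ _ hs
  have hXY : ∀ n, (X n)⁻¹ * Y n = (φ ^ ((n + 1) * k)) (FreeGroup.of a) := by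
    intro n
    induction n with
    | zero => simp [X, Y, heq, mul_assoc]
    | succ n ih =>
      have hX1 : X (n + 1) = X n * (φ ^ ((n + 1) * k)) p⁻¹ := by
        simp [X, List.range_succ]
      have hY1 : Y (n + 1) = Y n * (φ ^ ((n + 1) * k)) s := by
        simp [Y, List.range_succ, mul_assoc]
      have h1 : (φ ^ ((n + 1 + 1) * k)) (FreeGroup.of a) =
          (φ ^ ((n + 1) * k)) ((φ ^ k) (FreeGroup.of a)) := by
        rw [← MulAut.mul_apply, ← pow_add]
        congr 2
        ring
      rw [h1, heq, map_mul, map_mul, ← ih, hX1, hY1, mul_inv_rev, map_inv, inv_inv]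
      group
  have hfol : ∀ n, ∃ x y, x < y ∧ ∀ z, z = x ∨ z = y →
      δ.Follows (X n).toWord z ∧ δ.Follows (Y n).toWord z := by
    intro n
    have hpos : 0 < η ^ ((n + 1) * k) := pow_pos h.ratio_pos _
    have key : ∀ x ∈ δ.piece (a, true),
        δ.Follows (X n).toWord (η ^ ((n + 1) * k) * x + δ.transl (X n)⁻¹) ∧
        δ.Follows (Y n).toWord (η ^ ((n + 1) * k) * x + δ.transl (X n)⁻¹) := by
      intro x hx
      have h1 : δ.Follows (FreeGroup.of a).toWord x := by
        rw [FreeGroup.toWord_of]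
        exact follows_singleton.mpr hx
      have h2 := h.follows_pow ha h1 ((n + 1) * k)
      rw [← hXY, IsSigned.toWord_mul (hXs n).inv (hYs n), follows_append,
        FreeGroup.mk_toWord] at h2
      refine ⟨?_, h2.2⟩
      have h3 := h2.1.invRev
      rwa [FreeGroup.mk_toWord, ← FreeGroup.toWord_inv, inv_inv] at h3
    have hlen := δ.len_pos a
    refine ⟨η ^ ((n + 1) * k) * δ.edge (a, true) + δ.transl (X n)⁻¹,
      η ^ ((n + 1) * k) * (δ.edge (a, true) + δ.len a) + δ.transl (X n)⁻¹, ?_, ?_⟩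
    · gcongr
      linarith
    · rintro z (rfl | rfl)
      · exact key _ ⟨le_rfl, by simp only; linarith⟩
      · exact key _ ⟨by linarith, le_rfl⟩
  refine ⟨?_, fun n => ?_⟩
  · rintro (_ | _)
    · exact hX.signed hXs
    · exact hY.signed hYs
  · obtain ⟨m, h1, h2⟩ := ((hX.eventually_pre_prefix n).and (hY.eventually_pre_prefix n)).exists
    obtain ⟨x, y, hxy, hz⟩ := hfol m
    have hw : ∀ z, z = x ∨ z = y → δ.Window Z.ends n z := by
      rintro z hz' (_ | _)
      · exact (hz z hz').1.of_prefix h1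
      · exact (hz z hz').2.of_prefix h2
    exact ⟨x, y, hxy, hw x (Or.inl rfl), hw y (Or.inr rfl)⟩

theorem admissible_of_mem_attractingSubshift (h : SelfInduces δ φ η) {W : DoubleBoundary A}
    (hW : W ∈ attractingSubshift φ) : δ.Admissible W.ends := by
  obtain ⟨Z, hZ, hW⟩ := hW
  have hZ' := h.admissible_of_isAttractingPoint hZ
  -- Fixing finitely many letters is an open condition, so each window of `W` is also a window of a
  -- point of the orbit.
  have key : ∀ n, ∃ Z' : DoubleBoundary A, δ.Admissible Z'.ends ∧
      ∀ e, ∀ i ∈ Finset.range n, (Z'.ends e).letter i = (W.ends e).letter i := by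
    intro n
    have hopen : IsOpen (⋂ e : Bool, ⋂ i ∈ Finset.range n,
        {Z' : DoubleBoundary A | (Z'.ends e).letter i = (W.ends e).letter i}) :=
      isOpen_iInter_of_finite fun e => isOpen_biInter_finset fun i _ =>
        DoubleBoundary.isOpen_letter_eq e i _
    obtain ⟨Z', hmem, m, rfl⟩ := mem_closure_iff.mp hW _ hopen (by simp)
    refine ⟨_, hZ'.shiftPow m, ?_⟩
    simpa using hmem
  refine ⟨fun e i => ?_, fun n => ?_⟩
  · obtain ⟨Z', hadm, heq⟩ := key (i + 1)
    rw [← heq e i (by simp)]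
    exact hadm.1 e i
  · obtain ⟨Z', hadm, heq⟩ := key n
    have hpre : ∀ e, (Z'.ends e).pre n = (W.ends e).pre n := fun e =>
      List.map_congr_left fun i hi => heq e i (by simpa using hi)
    have hw : ∀ x, δ.Window Z'.ends n x → δ.Window W.ends n x := fun x hx e => by
      rw [← hpre e]
      exact hx e
    obtain ⟨x, y, hxy, hx, hy⟩ := hadm.2 n
    exact ⟨x, y, hxy, hw x hx, hw y hy⟩

/-! ### Images and fixed points -/

theorem exists_image (h : SelfInduces δ φ η) (k : ℕ) {R : Bool → FreeBoundary A}
    (hR : Oriented R) : ∃ R', Oriented R' ∧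
      (∀ e, FreeBoundary.MapsTo (φ ^ k) (R e) (R' e)) ∧
      ∀ n, ∃ m, ∀ x, δ.Window R m x → δ.Window R' n (η ^ k * x) := by
  choose R' hR' hmap using fun e => FreeBoundary.exists_mapsTo (h.preservesSign.pow k) (hR e)
  refine ⟨R', hR', hmap, fun n => ?_⟩
  obtain ⟨m, hm⟩ := (Filter.eventually_all.mpr fun e =>
    (hmap e).eventually_pre_prefix n).exists
  refine ⟨m, fun x hx e => ?_⟩
  refine Follows.of_prefix (h.follows_pow ((hR e).isSigned_initial m) ?_ k) (hm e)
  rw [(hR e).toWord_initial]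
  exact hx e

/-- A line fixed by `i_w ∘ φᵏ` is coded by the fixed point of `x ↦ ηᵏ x + τ(w)`. -/
theorem sideCoded_of_mapsTo (h : SelfInduces δ φ η) {k : ℕ} (hk : 1 ≤ k) {w : FreeGroup A}
    {R : Bool → FreeBoundary A} (hR : δ.Admissible R)
    (hfix : ∀ e, FreeBoundary.MapsTo (conjugacy w * φ ^ k) (R e) (R e)) {x : ℝ}
    (hx : δ.transl w = (1 - η ^ k) * x) :
    δ.SideCoded 1 R x ∨ δ.SideCoded (-1) R x := by
  obtain ⟨R', hR', hmap, hwin⟩ := h.exists_image k hR.1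
  have hact : ∀ e, R' e = FreeBoundary.act w (R e) := fun e =>
    (hmap e).unique (FreeBoundary.mapsTo_conjugacy_mul_iff.mp (hfix e))
  have hact' : (fun e => FreeBoundary.act (FreeGroup.mk w⁻¹.toWord) (R' e)) = R := by
    funext e
    rw [FreeGroup.mk_toWord, hact, FreeBoundary.act_inv_act]
  -- The contraction `y ↦ ηᵏ y + τ(w)` sends codings of `R` to codings of `R`: apply `φᵏ`, which
  -- yields `w R`, then return by `w⁻¹`.
  have hf : ∀ n, ∃ m, ∀ y, δ.Window R m y → δ.Window R n (η ^ k * y + (1 - η ^ k) * x) := by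
    intro n
    obtain ⟨m, hm⟩ := exists_window_act δ (L := w⁻¹.toWord) FreeGroup.isReduced_toWord hR'
      (by rw [hact']; exact hR.1) n
    obtain ⟨m', hm'⟩ := hwin m
    refine ⟨m', fun y hy => ?_⟩
    have := hm _ (hm' y hy)
    rwa [hact', FreeGroup.mk_toWord, transl_inv, sub_neg_eq_add, hx] at this
  have hη0 := h.ratio_pos
  have hη1 : η ^ k < 1 := pow_lt_one₀ hη0.le h.ratio_lt_one (by omega)
  obtain ⟨y, hy⟩ : ∃ y, ∀ n, δ.Window R n y := by
    -- The index is `n + 1` because the empty window is followed by every real number, hence is not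
    -- compact.
    have hne : (⋂ n, {y | δ.Window R (n + 1) y}).Nonempty := by
      apply IsCompact.nonempty_iInter_of_sequence_nonempty_isCompact_isClosed
      · exact fun n y hy => Window.mono (Nat.le_succ _) hy
      · intro n
        obtain ⟨y, _, _, hy, _⟩ := hR.2 (n + 1)
        exact ⟨y, hy⟩
      · exact IsCompact.of_isClosed_subset (s := δ.piece ((R true).letter 0)) isCompact_Icc
          (isClosed_window δ R 1) fun y hy => Window.mem_piece hy true
      · exact fun n => isClosed_window δ R (n + 1)
    obtain ⟨y, hy⟩ := hne
    exact ⟨y, fun n => Window.mono n.le_succ (Set.mem_iInter.mp hy n)⟩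
  have hiter : ∀ i n, δ.Window R n (x + (η ^ k) ^ i * (y - x)) := by
    intro i
    induction i with
    | zero => intro n; simpa using hy n
    | succ i ih =>
      intro n
      obtain ⟨m, hm⟩ := hf n
      convert hm _ (ih m) using 1
      ring
  have hxw : ∀ n, δ.Window R n x := by
    intro n
    have ht : Filter.Tendsto (fun i : ℕ => x + (η ^ k) ^ i * (y - x)) Filter.atTop (nhds x) := by
      have h0 := tendsto_pow_atTop_nhds_zero_of_lt_one (pow_pos hη0 k).le hη1
      simpa using (h0.mul_const (y - x)).const_add x
    exact (isClosed_window δ R n).mem_of_tendsto ht (Filter.Eventually.of_forall fun i => hiter i n)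
  have hnear : ∀ d : ℝ, 0 < d → ∀ᶠ ε in nhdsWithin 0 (Set.Ioi 0), 0 < ε ∧ ε < d := fun d hd => by
    filter_upwards [Ioo_mem_nhdsGT hd] with ε hε using hε
  -- If some window has no point to the right of `x`, every larger window is a nondegenerate
  -- interval ending at `x`, and `x` is approached from the left.
  by_cases hright : ∀ n, ∃ z, x < z ∧ δ.Window R n z
  · left
    refine fun n => ⟨hxw n, ?_⟩
    obtain ⟨z, hz, hzw⟩ := hright n
    filter_upwards [hnear (z - x) (by linarith)] with ε hε
    exact (hxw n).convex hzw (by linarith [hε.1]) (by linarith [hε.2])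
  · right
    push Not at hright
    obtain ⟨n₀, hn₀⟩ := hright
    refine fun n => ⟨hxw n, ?_⟩
    obtain ⟨y₁, y₂, hlt, h1, h2⟩ := hR.2 (max n n₀)
    have hy2 : y₂ ≤ x := by
      by_contra hc
      exact hn₀ y₂ (not_le.mp hc) (h2.mono (le_max_right _ _))
    filter_upwards [hnear (x - y₁) (by linarith)] with ε hε
    exact (h1.mono (le_max_left _ _)).convex (hxw n) (by linarith [hε.2]) (by linarith [hε.1])

/-- A line coded by an endpoint of a piece is fixed by `i_p ∘ φ`, if `p` is the itinerary
that relates this endpoint to its image. -/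
theorem mapsTo_of_sideCoded (h : SelfInduces δ φ η) {s : ℝ} (hs : s ≠ 0) {e : Bool}
    {p : FreeGroup A} (hp : IsSigned e p) {x : ℝ}
    (hpx : ∀ᶠ z in nhds (η * x), δ.Follows p.toWord z) (hxp : x = η * x + δ.transl p)
    {R : Bool → FreeBoundary A} (hR : Oriented R) (hc : δ.SideCoded s R x) (e' : Bool) :
    FreeBoundary.MapsTo (conjugacy p * φ) (R e') (R e') := by
  obtain ⟨R₁, hR₁, hmap, hwin⟩ := h.exists_image 1 hR
  rw [pow_one] at hmap
  simp only [pow_one] at hwin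
  have hη := h.ratio_pos
  have hc₁ : δ.SideCoded s R₁ (η * x) := by
    intro n
    obtain ⟨m, hm⟩ := hwin n
    refine ⟨hm x (hc m).1, ?_⟩
    -- Scaling by `η > 0` keeps the side: the point `ηx + s ε` is the image of `x + s (ε / η)`.
    have ht : Filter.Tendsto (fun ε : ℝ => ε / η) (nhdsWithin 0 (Set.Ioi 0))
        (nhdsWithin 0 (Set.Ioi 0)) := by
      apply tendsto_nhdsWithin_of_tendsto_nhds_of_eventually_within
      · have : Continuous fun ε : ℝ => ε / η := by fun_prop
        have h0 := (this.tendsto 0).mono_left (nhdsWithin_le_nhds (s := Set.Ioi 0))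
        simpa using h0
      · filter_upwards [self_mem_nhdsWithin] with ε hε
        exact div_pos hε hη
    filter_upwards [ht.eventually (hc m).2] with ε hε
    convert hm _ hε using 1
    field_simp
  obtain ⟨R₂, hR₂, hc₂, hact⟩ := hc₁.exists_act_eq hs hp hpx hR₁
  rw [FreeGroup.mk_toWord, ← hxp] at hc₂
  rw [FreeBoundary.mapsTo_conjugacy_mul_iff]
  have h1 := hmap e'
  rw [hact, FreeGroup.mk_toWord, SideCoded.ext_of_oriented hs hR₂ hR hc₂ hc] at h1
  exact h1

/-- All powers of `i_p ∘ φ` act on the real line with the same fixed point `x`; the recursion is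
`(i_p ∘ φ) ∘ (i_g ∘ φᵐ) = i_{φ(g) p} ∘ φᵐ⁺¹`. -/
theorem exists_conjugacy_mul_pow (h : SelfInduces δ φ η) {p : FreeGroup A} {x : ℝ}
    (hxp : x = η * x + δ.transl p) (m : ℕ) :
    ∃ g, (conjugacy p * φ) ^ m = conjugacy g * φ ^ m ∧ δ.transl g = (1 - η ^ m) * x := by
  induction m with
  | zero => exact ⟨1, by simp [conjugacy], by simp [transl_one]⟩
  | succ m ih =>
    obtain ⟨g, hg, ht⟩ := ih
    refine ⟨φ g * p, ?_, ?_⟩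
    · rw [pow_succ', hg]
      ext1 v
      simp [conjugacy, pow_succ', mul_assoc]
    · rw [transl_mul, h.transl_map, ht, pow_succ']
      linear_combination -hxp

end SelfInduces

end CIET

/-! ### Proof of the proposition -/

theorem DoubleBoundary.isFixed_iff {A : Type*} [DecidableEq A] {φ : MulAut (FreeGroup A)}
    {Z : DoubleBoundary A} :
    Z.IsFixed φ ↔ ∀ e, FreeBoundary.MapsTo φ (Z.ends e) (Z.ends e) := by
  rw [Bool.forall_bool]
  rfl

theorem DoubleBoundary.ends_injective {A : Type*} :
    Function.Injective (DoubleBoundary.ends (A := A)) := by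
  intro Z Z' h
  ext1
  · exact congrFun h false
  · exact congrFun h true

/-- Let `φ` be the `δ`-automorphism of a self-induced completed interval exchange transformation
`δ`. Every `φ`-singularity is fixed by `i_w ∘ φ` for some element `w` of the free group. -/
theorem mainTheorem6 {A : Type*} [Fintype A] [DecidableEq A] [Nontrivial A]
    (δ : CIET A) (hδ : δ.IsSelfInduced) (Ω : Set (DoubleBoundary A))
    (hΩ : IsSingularity (δ.deltaAutomorphism hδ) Ω) :
    ∃ w : FreeGroup A, FixesSingularity (δ.deltaAutomorphism hδ)
      (conjugacy w * δ.deltaAutomorphism hδ) Ω := by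
  obtain ⟨η, hη⟩ := δ.exists_selfInduces hδ
  set φ := δ.deltaAutomorphism hδ
  obtain ⟨ψ, hψ⟩ := hΩ
  obtain ⟨w, k, hk, rfl⟩ := hψ.eq_conjugacy_mul
  have hη1 : η ^ k < 1 := pow_lt_one₀ hη.ratio_pos.le hη.ratio_lt_one (by omega)
  have hadm : ∀ Z ∈ attractingSubshift φ, δ.Admissible Z.ends := fun Z hZ =>
    hη.admissible_of_mem_attractingSubshift hZ
  -- The fixed point of `y ↦ ηᵏ y + τ(w)`, common to all the lines of `Ω`.
  obtain ⟨x, hx⟩ : ∃ x, δ.transl w = (1 - η ^ k) * x :=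
    ⟨δ.transl w / (1 - η ^ k), by rw [mul_div_cancel₀]; linarith⟩
  have hcoded : ∀ Z ∈ Ω, δ.SideCoded 1 Z.ends x ∨ δ.SideCoded (-1) Z.ends x := fun Z hZ =>
    hη.sideCoded_of_mapsTo hk (hadm Z (hψ.subset hZ))
      (DoubleBoundary.isFixed_iff.mp (hψ.isFixed Z hZ)) hx
  have hpiece : ∀ Z ∈ Ω, ∀ e, x ∈ δ.piece ((Z.ends e).letter 0) := fun Z hZ e => by
    rcases hcoded Z hZ with h | h
    · exact (h 1).1.mem_piece e
    · exact (h 1).1.mem_piece e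
  -- Two lines of `Ω` with different first letters at the same end put `x` in two pieces of the same
  -- sign.
  obtain ⟨l, hl⟩ : ∃ l, x = δ.edge l := by
    obtain ⟨Z, hZ, Z', hZ', hne⟩ := hψ.exists_ne
    obtain ⟨e, he⟩ : ∃ e, (Z.ends e).letter 0 ≠ (Z'.ends e).letter 0 := by
      rcases hne with h | h
      · exact ⟨true, h⟩
      · exact ⟨false, h⟩
    have hsign : ((Z.ends e).letter 0).2 = ((Z'.ends e).letter 0).2 :=
      ((hadm Z (hψ.subset hZ)).1 e 0).trans ((hadm Z' (hψ.subset hZ')).1 e 0).symm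
    rcases CIET.eq_edge_of_mem_piece hsign he (hpiece Z hZ e) (hpiece Z' hZ' e) with h | h
    · exact ⟨_, h⟩
    · exact ⟨_, h⟩
  obtain ⟨p, hp, hpx, hxp⟩ := hη.edge_eq l
  rw [← hl] at hpx hxp
  refine ⟨p, hψ.subset, hψ.nontrivial, ⟨p, 1, le_rfl, by rw [pow_one]⟩, fun Z hZ => ?_, ?_,
    hψ.exists_ne⟩
  · rw [DoubleBoundary.isFixed_iff]
    intro e
    have hor := (hadm Z (hψ.subset hZ)).1
    rcases hcoded Z hZ with h | h
    · exact hη.mapsTo_of_sideCoded one_ne_zero hp hpx hxp hor h e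
    · exact hη.mapsTo_of_sideCoded (by norm_num) hp hpx hxp hor h e
  · intro m hm Z hZ hfix
    obtain ⟨g, hg, hgt⟩ := hη.exists_conjugacy_mul_pow hxp m
    rw [hg, DoubleBoundary.isFixed_iff] at hfix
    have huniq : ∀ s : ℝ, s ≠ 0 → ∀ Z₁ ∈ attractingSubshift φ, ∀ Z₂ ∈ attractingSubshift φ,
        δ.SideCoded s Z₁.ends x → δ.SideCoded s Z₂.ends x → Z₁ = Z₂ :=
      fun s hs Z₁ h₁ Z₂ h₂ hc₁ hc₂ => DoubleBoundary.ends_injective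
        (hc₁.ext_of_oriented hs (hadm Z₁ h₁).1 (hadm Z₂ h₂).1 hc₂)
    -- Two distinct lines of `Ω` are coded on opposite sides of `x`, so `Z` shares its side with one
    -- of them and equals it.
    obtain ⟨Z₁, h₁, Z₂, h₂, hne⟩ := hψ.nontrivial
    have h10 : (1 : ℝ) ≠ 0 := one_ne_zero
    have h11 : (-1 : ℝ) ≠ 0 := by norm_num
    rcases hη.sideCoded_of_mapsTo hm (hadm Z hZ) hfix hgt with h | h <;>
      rcases hcoded Z₁ h₁ with hc₁ | hc₁ <;> rcases hcoded Z₂ h₂ with hc₂ | hc₂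
    · exact absurd (huniq 1 h10 Z₁ (hψ.subset h₁) Z₂ (hψ.subset h₂) hc₁ hc₂) hne
    · rwa [huniq 1 h10 Z hZ Z₁ (hψ.subset h₁) h hc₁]
    · rwa [huniq 1 h10 Z hZ Z₂ (hψ.subset h₂) h hc₂]
    · exact absurd (huniq (-1) h11 Z₁ (hψ.subset h₁) Z₂ (hψ.subset h₂) hc₁ hc₂) hne
    · exact absurd (huniq 1 h10 Z₁ (hψ.subset h₁) Z₂ (hψ.subset h₂) hc₁ hc₂) hne
    · rwa [huniq (-1) h11 Z hZ Z₂ (hψ.subset h₂) h hc₂]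
    · rwa [huniq (-1) h11 Z hZ Z₁ (hψ.subset h₁) h hc₁]
    · exact absurd (huniq (-1) h11 Z₁ (hψ.subset h₁) Z₂ (hψ.subset h₂) hc₁ hc₂) hne
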